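/- **Adiabatic theorem for continuous spectra.** Let $\mathcal H$ be a complex Hilbert space, $\hbar>0$, and let $$H(s)=\int_\Omega E(k,s)\,|\varphi(k,s)\rangle\langle\varphi(k,s)|\,dk ,\qquad 0\le s\le 1,$$ be a family of self-adjoint operators with purely continuous, non-degenerate spectrum. Here $\Omega\subseteq\mathbb R$ is a measurable set of labels; for each $s$ the function $k\mapsto E(k,s)$ is real, measurable, and injective on $\Omega$; and the generalized eigenfunctions $|\varphi(k,s)\rangle$, $k\in\Omega$, form a complete system normalized to $\delta$-functions. This means that the expansion $\psi\mapsto\big(k\mapsto\langle\varphi(k,s)|\psi\rangle\big)$ is an isometric isomorphism of $\mathcal H$ onto $L^2(\Omega,dk)$, which carries $H(s)$ into multiplication by $E(\cdot,s)$ with its maximal domain. Its inverse is $C\mapsto\int_\Omega C(k)|\varphi(k,s)\rangle\,dk$. Assume the following regularity in $s$. There is a constant $L$ such that for every $k\in\Omega$ the function $E(k,\cdot)$ is continuous on $[0,1]$ and, outside a finite set of points (which may depend on $k$), differentiable with $|\partial_sE(k,s)|\le L\,(1+|E(k,s)|)$. For every $C\in L^2(\Omega,dk)$ the wave packet $\int_\Omega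 C(k)|\varphi(k,s)\rangle\,dk$ is a continuously differentiable function of $s\in[0,1]$. Fix $k\in\mathbb R$ and $\delta k>0$, and let $$\delta P(k;s)=\int_{\Omega\cap[k,k+\delta k]}|\varphi(k',s)\rangle\langle\varphi(k',s)|\,dk'$$ be the differential projector. Assume: 1. (Virtual gap, no level crossing.) $|E(k',s)-E(k'',s)|\gg 1/T$ as $T\to\infty$, uniformly in $s\in[0,1]$, $k'\in\Omega\cap[k,k+\delta k]$ and $k''\in\Omega\setminus[k,k+\delta k]$; that is, for every $M$ one has $|E(k',s)-E(k'',s)|\ge M/T$ for all such $s,k',k''$ as soon as $T$ is large enough. (Equivalently, these differences are bounded below by some $g>0$. In particular no level outside the window ever meets a level inside.) 2. The energies $E(k',s)$, $k'\in\Omega\cap[k,k+\delta k]$, $s\in[0,1]$, form a bounded set. 3. $s\mapsto\delta P(k;s)$ is twice continuously differentiable on $[0,1]$ in the operator norm. For $T>0$ let $U_T(s)$, $0\le s\le1$, denote the evolution operator: $U_T(s)$ is unitary, $U_T(0)=I$, and for every $\psi$ in the domain of $H(0)$ the vector $U_T(s)\psi$ lies in the domain of $H(s)$, is differentiable in $s$,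 and satisfies $i\hbar\,\partial_sU_T(s)\psi=T\,H(s)\,U_T(s)\psi$. Then there is a constant $C$, independent of $T$ and $s$, such that for every $T>0$ for which an evolution operator $U_T$ exists and every $s\in[0,1]$, $$\big\|U_T(s)\,\delta P(k;0)-\delta P(k;s)\,U_T(s)\big\|\le \frac CT ,$$ i.e. $U_T(s)\,\delta P(k;0)=\delta P(k;s)\,U_T(s)+O(1/T)$ as $T\to\infty$, uniformly in $s$. In particular, a state starting in the window $[k,k+\delta k]$ stays in it up to $O(1/T)$: if $\delta P(k;0)\psi=\psi$, then $$\big\|U_T(s)\psi-\delta P(k;s)U_T(s)\psi\big\|\le\frac CT\,\|\psi\| .$$ -/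

import Mathlib

open MeasureTheory Set Filter

namespace AdiabaticContinuous

noncomputable section

/-- The space `L²(Ω, dk)` of amplitudes `k ↦ C(k)` over a set `Ω ⊆ ℝ` of labels. -/
abbrev Amplitude (Ω : Set ℝ) : Type := Lp ℂ 2 (volume.restrict Ω)

theorem memLp_indicator {Ω J : Set ℝ} (hJ : MeasurableSet J) (f : Amplitude Ω) :
    MemLp (J.indicator fun k => f k) 2 (volume.restrict Ω) :=
  (Lp.memLp f).indicator hJ

/-- Restriction of amplitudes to a measurable set `J` of labels, `C ↦ 1_J C` on `L²(Ω, dk)`, as a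
linear map. -/
def cutoffLinear (Ω J : Set ℝ) (hJ : MeasurableSet J) : Amplitude Ω →ₗ[ℂ] Amplitude Ω where
  toFun f := MemLp.toLp (J.indicator fun k => f k) (memLp_indicator hJ f)
  map_add' := by
    intro f g
    rw [← MemLp.toLp_add]
    refine (MemLp.toLp_eq_toLp_iff _ _).2 ?_
    filter_upwards [Lp.coeFn_add f g] with x hx
    rw [Pi.add_apply] at hx ⊢
    by_cases h : x ∈ J
    · simp only [indicator_of_mem h]; exact hx
    · simp only [indicator_of_notMem h, add_zero]
  map_smul' := by
    intro c f
    rw [RingHom.id_apply, ← MemLp.toLp_const_smul]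
    refine (MemLp.toLp_eq_toLp_iff _ _).2 ?_
    filter_upwards [Lp.coeFn_smul c f] with x hx
    rw [Pi.smul_apply] at hx ⊢
    by_cases h : x ∈ J
    · simp only [indicator_of_mem h]; exact hx
    · simp only [indicator_of_notMem h, smul_zero]

theorem coeFn_cutoffLinear (Ω J : Set ℝ) (hJ : MeasurableSet J) (f : Amplitude Ω) :
    ∀ᵐ x ∂(volume.restrict Ω), cutoffLinear Ω J hJ f x = J.indicator (fun k => f k) x := by
  have h : cutoffLinear Ω J hJ f = MemLp.toLp _ (memLp_indicator hJ f) := rfl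
  rw [h]
  exact MemLp.coeFn_toLp (memLp_indicator hJ f)

theorem norm_cutoffLinear_le (Ω J : Set ℝ) (hJ : MeasurableSet J) (f : Amplitude Ω) :
    ‖cutoffLinear Ω J hJ f‖ ≤ 1 * ‖f‖ := by
  rw [one_mul]
  refine Lp.norm_le_norm_of_ae_le ?_
  filter_upwards [coeFn_cutoffLinear Ω J hJ f] with x hx
  rw [hx]
  exact norm_indicator_le_norm_self (fun k => f k) x

/-- The restriction `C ↦ 1_J C` as a bounded operator on `L²(Ω, dk)`. -/
def cutoff (Ω J : Set ℝ) (hJ : MeasurableSet J) : Amplitude Ω →L[ℂ] Amplitude Ω :=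
  (cutoffLinear Ω J hJ).mkContinuous 1 (norm_cutoffLinear_le Ω J hJ)

/-- Multiplication by a real function `e` on `L²(Ω, dk)`, with its maximal domain
`{C | e C ∈ L²(Ω, dk)}`. -/
def mulOperator (Ω : Set ℝ) (e : ℝ → ℝ) : Amplitude Ω →ₗ.[ℂ] Amplitude Ω where
  domain :=
    { carrier := {f | MemLp (fun k => (e k : ℂ) * f k) 2 (volume.restrict Ω)}
      add_mem' := by
        intro f g hf hg
        refine (memLp_congr_ae ?_).1 (MemLp.add hf hg)
        filter_upwards [Lp.coeFn_add f g] with x hx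
        rw [hx]
        simp only [Pi.add_apply, mul_add]
      zero_mem' := by
        refine (memLp_congr_ae ?_).1 (MemLp.zero (ε := ℂ))
        filter_upwards [Lp.coeFn_zero ℂ 2 (volume.restrict Ω)] with x hx
        rw [hx]
        simp only [Pi.zero_apply, mul_zero]
      smul_mem' := by
        intro c f hf
        refine (memLp_congr_ae ?_).1 (MemLp.const_smul hf c)
        filter_upwards [Lp.coeFn_smul c f] with x hx
        simp only [Pi.smul_apply, smul_eq_mul, hx]
        ring }
  toFun :=
    { toFun := fun f => MemLp.toLp _ f.2
      map_add' := by
        intro f g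
        rw [← MemLp.toLp_add]
        refine (MemLp.toLp_eq_toLp_iff _ _).2 ?_
        filter_upwards [Lp.coeFn_add (f : Amplitude Ω) g] with x hx
        simp only [Submodule.coe_add, Pi.add_apply]
        rw [hx]
        simp only [Pi.add_apply, mul_add]
      map_smul' := by
        intro c f
        rw [RingHom.id_apply, ← MemLp.toLp_const_smul]
        refine (MemLp.toLp_eq_toLp_iff _ _).2 ?_
        filter_upwards [Lp.coeFn_smul c (f : Amplitude Ω)] with x hx
        simp only [Submodule.coe_smul, Pi.smul_apply, smul_eq_mul, hx]
        ring }

variable {𝓗 : Type*} [NormedAddCommGroup 𝓗] [InnerProductSpace ℂ 𝓗]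

variable (𝓗) in
/-- The spectral data of a time-dependent Hamiltonian
`H(s) = ∫_Ω E(k,s) |φ(k,s)⟩⟨φ(k,s)| dk`, `0 ≤ s ≤ 1`, with purely continuous, non-degenerate
spectrum.

The kets `|φ(k,s)⟩` are generalized eigenvectors, which do not lie in `𝓗`.  The assertion that they
are complete and normalized to delta functions,
`∫_Ω |φ(k,s)⟩⟨φ(k,s)| dk = 1` and `⟨φ(k,s)|φ(k',s)⟩ = δ(k - k')`, means that the eigenfunction
expansion `ψ ↦ (k ↦ ⟨φ(k,s)|ψ⟩)` is an isometric isomorphism of `𝓗` onto `L²(Ω, dk)`; its inverse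
forms the wave packets `C ↦ ∫_Ω C(k) |φ(k,s)⟩ dk`. -/
structure ContinuousSpectrum where
  /-- the set `Ω` of labels `k` -/
  labels : Set ℝ
  measurableSet_labels : MeasurableSet labels
  /-- `energy k s` is `E(k,s)` -/
  energy : ℝ → ℝ → ℝ
  measurable_energy : ∀ s ∈ Icc (0 : ℝ) 1, Measurable fun k => energy k s
  /-- Distinct labels have distinct energies, so every energy has multiplicity one and, single
  labels being null sets, none of them is an eigenvalue. -/
  nondegenerate : ∀ s ∈ Icc (0 : ℝ) 1, InjOn (fun k => energy k s) labels
  /-- `expansion s ψ` is the amplitude `k ↦ ⟨φ(k,s)|ψ⟩` -/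
  expansion : ℝ → 𝓗 ≃ₗᵢ[ℂ] Amplitude labels

namespace ContinuousSpectrum

variable (S : ContinuousSpectrum 𝓗)

/-- The wave packet `∫_Ω C(k) |φ(k,s)⟩ dk` with amplitude `C`. -/
def packet (s : ℝ) (C : Amplitude S.labels) : 𝓗 := (S.expansion s).symm C

/-- The self-adjoint operator `H(s) = ∫_Ω E(k,s) |φ(k,s)⟩⟨φ(k,s)| dk`: it maps
`∫ C(k) |φ(k,s)⟩ dk` to `∫ E(k,s) C(k) |φ(k,s)⟩ dk`, and its domain is formed by all vectors for
which `k ↦ E(k,s) C(k)` is square integrable. -/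
def hamiltonian (s : ℝ) : 𝓗 →ₗ.[ℂ] 𝓗 where
  domain := (mulOperator S.labels fun k => S.energy k s).domain.comap
    ((S.expansion s).toLinearEquiv : 𝓗 →ₗ[ℂ] Amplitude S.labels)
  toFun :=
    { toFun := fun ψ =>
        S.packet s (mulOperator S.labels (fun k => S.energy k s) ⟨S.expansion s ψ, ψ.2⟩)
      map_add' := by
        intro ψ χ
        rw [packet, packet, packet, ← map_add, ← LinearPMap.map_add]
        congr 2
        exact Subtype.ext (map_add (S.expansion s) _ _)
      map_smul' := by
        intro c ψ
        rw [packet, packet, RingHom.id_apply, ← map_smul, ← LinearPMap.map_smul]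
        congr 2
        exact Subtype.ext (map_smul (S.expansion s) c (ψ : 𝓗)) }

/-- The differential projector
`δP(k;s) = ∫_{k}^{k+δk} |φ(k',s)⟩⟨φ(k',s)| dk'`. -/
def diffProjector (k δk s : ℝ) : 𝓗 →L[ℂ] 𝓗 :=
  ((S.expansion s).symm : Amplitude S.labels →L[ℂ] 𝓗) ∘L
    cutoff S.labels (Icc k (k + δk)) measurableSet_Icc ∘L
      ((S.expansion s) : 𝓗 →L[ℂ] Amplitude S.labels)

/-- `U` is the evolution operator `s ↦ U_T(s)`, `0 ≤ s ≤ 1`: it is unitary, `U_T(0) = 1`, and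
`iħ (∂/∂s) U_T(s) = T H(s) U_T(s)` holds on the vectors of the domain of `H(0)`. -/
structure IsEvolution (ħ T : ℝ) (U : ℝ → 𝓗 →L[ℂ] 𝓗) : Prop where
  initial : U 0 = 1
  isometry : ∀ s ∈ Icc (0 : ℝ) 1, ∀ ψ, ‖U s ψ‖ = ‖ψ‖
  surjective : ∀ s ∈ Icc (0 : ℝ) 1, Function.Surjective (U s)
  schroedinger : ∀ ψ ∈ (S.hamiltonian 0).domain, ∀ s ∈ Icc (0 : ℝ) 1,
    ∃ h : U s ψ ∈ (S.hamiltonian s).domain, ∃ v : 𝓗,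
      HasDerivWithinAt (fun r => U r ψ) v (Icc 0 1) s ∧
        (Complex.I * (ħ : ℂ)) • v = (T : ℂ) • S.hamiltonian s ⟨U s ψ, h⟩

/-- The virtual gap: `|E(k',s) - E(k'',s)| ≫ 1/T` as `T → ∞`, uniformly in `s ∈ [0,1]`, in the
labels `k'` in the window `[k, k+δk]` and in the labels `k''` outside it.  In particular, no level
outside the window ever meets a level inside. -/
def VirtualGap (k δk : ℝ) : Prop :=
  ∀ M : ℝ, ∀ᶠ T : ℝ in atTop, ∀ s ∈ Icc (0 : ℝ) 1,
    ∀ k' ∈ S.labels ∩ Icc k (k + δk), ∀ k'' ∈ S.labels \ Icc k (k + δk),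
      M * (1 / T) ≤ |S.energy k' s - S.energy k'' s|

/-- The energies in the window `[k, k+δk]` form a bounded set. -/
def BoundedWindow (k δk : ℝ) : Prop :=
  ∃ M : ℝ, ∀ s ∈ Icc (0 : ℝ) 1, ∀ k' ∈ S.labels ∩ Icc k (k + δk), |S.energy k' s| ≤ M

/-- The energies are continuous and piecewise differentiable functions of `s` (the finitely many
break points may depend on `k`), and change at a relative rate that is bounded uniformly in `k`. -/
def PiecewiseDifferentiableEnergy : Prop :=
  ∃ L : ℝ, ∀ k ∈ S.labels, ContinuousOn (S.energy k) (Icc 0 1) ∧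
    ∃ N : Set ℝ, N.Finite ∧ ∀ s ∈ Icc (0 : ℝ) 1 \ N, ∃ e' : ℝ,
      HasDerivWithinAt (S.energy k) e' (Icc 0 1) s ∧ |e'| ≤ L * (1 + |S.energy k s|)

/-- The generalized eigenfunctions have derivatives `|∂φ(k,s)/∂s⟩`, continuous in `s`, in the sense
of wave packets: for every amplitude `C`, the packet `∫ C(k) |φ(k,s)⟩ dk` is a continuously
differentiable function of `s`. -/
def DifferentiableEigenfunctions : Prop :=
  ∀ C : Amplitude S.labels, ContDiffOn ℝ 1 (fun s => S.packet s C) (Icc 0 1)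

end ContinuousSpectrum

end

end AdiabaticContinuous

/-! Write `P` for the differential projector. The gap makes the commutator equation `[H, X] = P'`
solvable by a bounded `X` that is Lipschitz in `s`, and this turns the motion of `P` along the
evolution into a total derivative of size `1/T`. Put `γ = iħ/T`. Two solutions `u`, `w` of the
Schrödinger equation satisfy `H u = γ u'` and `H w = γ w'`; since `P` commutes with `H`, the
derivative of `⟨u, P w⟩` is `⟨u, P' w⟩`, which equals `-γ` times the derivative of `⟨u, X w⟩` with
`X` held fixed. Hence `⟨u, (P + γ X) w⟩` changes only through `γ` times the variation of `X`, and
`⟨u, P w⟩` varies by `O(1/T)` (`norm_inner_sub_inner_le`). The choice `U f = (U P₀ - P U) g` turns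
this bound on matrix elements into a bound in norm (`norm_comp_sub_comp_le`).

To find `X`, note that `P² = P` makes `P'` off-diagonal: `P' = P P' + P' P` with `P P' P = 0`. It
suffices to solve `[H, Z] = P P' (1 - P)` and take `X = Z - Z*`. On amplitudes `H` is multiplication
by the energy `e`. A part of the window with energies within `h` of `c` has outside levels at
distance at least `2h` from `c`; the equation then reads `Z = (e - c) Z (e - c)⁻¹ - χ Y (e - c)⁻¹`,
a contraction with constant `1/2`. Finitely many hat functions `χ` of the energy cover the bounded
window (`weak_commutator_windowHat`, `exists_lipFamily_weak_commutator`).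

Lipschitz dependence, rather than differentiability, is the right regularity: break points of the
energies may depend on the label, whereas the Lipschitz bounds are uniform in it. All commutators
are weak, as forms on the domain of the unbounded `H`. -/

namespace AdiabaticContinuous

open scoped Topology

noncomputable section

/-! ### Calculus of Lipschitz families on `[0,1]` -/

/-- A family of vectors that is bounded and Lipschitz continuous in `s ∈ [0,1]`. -/
def LipFamily {E : Type*} [SeminormedAddCommGroup E] (F : ℝ → E) : Prop :=
  ∃ K : ℝ, 0 ≤ K ∧ (∀ s ∈ Icc (0 : ℝ) 1, ‖F s‖ ≤ K) ∧
    ∀ s ∈ Icc (0 : ℝ) 1, ∀ t ∈ Icc (0 : ℝ) 1, ‖F s - F t‖ ≤ K * |s - t|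

namespace LipFamily

section Basic

variable {E F G : Type*} [SeminormedAddCommGroup E] [SeminormedAddCommGroup F]
  [SeminormedAddCommGroup G]

theorem of_bounds {f : ℝ → E} {A B : ℝ} (hA : ∀ s ∈ Icc (0 : ℝ) 1, ‖f s‖ ≤ A)
    (hB : ∀ s ∈ Icc (0 : ℝ) 1, ∀ t ∈ Icc (0 : ℝ) 1, ‖f s - f t‖ ≤ B * |s - t|) :
    LipFamily f := by
  refine ⟨max (max A B) 0, le_max_right _ _, fun s hs => (hA s hs).trans ?_, fun s hs t ht =>
    (hB s hs t ht).trans ?_⟩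
  · exact (le_max_left _ _).trans (le_max_left _ _)
  · exact mul_le_mul_of_nonneg_right ((le_max_right _ _).trans (le_max_left _ _)) (abs_nonneg _)

theorem of_lipschitz {f : ℝ → E} {B : ℝ}
    (hB : ∀ s ∈ Icc (0 : ℝ) 1, ∀ t ∈ Icc (0 : ℝ) 1, ‖f s - f t‖ ≤ B * |s - t|) :
    LipFamily f := by
  refine of_bounds (A := ‖f 0‖ + |B|) (fun s hs => ?_) hB
  have h0 : (0 : ℝ) ∈ Icc (0 : ℝ) 1 := by simp
  have h := hB s hs 0 h0
  have h1 : B * |s - 0| ≤ |B| := by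
    rw [sub_zero, abs_of_nonneg hs.1]
    nlinarith [le_abs_self B, hs.1, hs.2, abs_nonneg B]
  have h2 : ‖f s‖ ≤ ‖f 0‖ + ‖f s - f 0‖ := by
    simpa using norm_add_le (f 0) (f s - f 0)
  linarith

theorem zero : LipFamily (fun _ : ℝ => (0 : E)) :=
  ⟨0, le_rfl, by simp, by simp⟩

theorem add {f g : ℝ → E} (hf : LipFamily f) (hg : LipFamily g) :
    LipFamily fun s => f s + g s := by
  obtain ⟨K, -, hK, hK'⟩ := hf
  obtain ⟨L, -, hL, hL'⟩ := hg
  refine of_lipschitz (B := K + L) fun s hs t ht => ?_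
  rw [add_sub_add_comm, add_mul]
  exact (norm_add_le _ _).trans (add_le_add (hK' s hs t ht) (hL' s hs t ht))

theorem neg {f : ℝ → E} (hf : LipFamily f) : LipFamily fun s => -f s := by
  obtain ⟨K, h0, hK, hK'⟩ := hf
  refine ⟨K, h0, fun s hs => by rw [norm_neg]; exact hK s hs, fun s hs t ht => ?_⟩
  rw [← neg_sub', norm_neg]
  exact hK' s hs t ht

theorem sub {f g : ℝ → E} (hf : LipFamily f) (hg : LipFamily g) :
    LipFamily fun s => f s - g s := by
  simpa only [sub_eq_add_neg] using hf.add hg.neg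

theorem sum {ι : Type*} (u : Finset ι) {f : ι → ℝ → E} (hf : ∀ i ∈ u, LipFamily (f i)) :
    LipFamily fun s => ∑ i ∈ u, f i s := by
  classical
  induction u using Finset.induction_on with
  | empty => simpa using zero
  | insert a u ha ih =>
    simp only [Finset.sum_insert ha]
    exact (hf a (Finset.mem_insert_self _ _)).add
      (ih fun i hi => hf i (Finset.mem_insert_of_mem hi))

theorem bilinear {f : ℝ → E} {g : ℝ → F} (b : E → F → G)
    (hb : ∀ x y, ‖b x y‖ ≤ ‖x‖ * ‖y‖) (hl : ∀ x x' y, b (x - x') y = b x y - b x' y)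
    (hr : ∀ x y y', b x (y - y') = b x y - b x y') (hf : LipFamily f) (hg : LipFamily g) :
    LipFamily fun s => b (f s) (g s) := by
  obtain ⟨K, hK0, hK, hK'⟩ := hf
  obtain ⟨L, hL0, hL, hL'⟩ := hg
  refine of_lipschitz (B := K * L + K * L) fun s hs t ht => ?_
  have e : b (f s) (g s) - b (f t) (g t) = b (f s - f t) (g s) + b (f t) (g s - g t) := by
    rw [hl, hr]; abel
  rw [e, add_mul]
  refine (norm_add_le _ _).trans (add_le_add ((hb _ _).trans ?_) ((hb _ _).trans ?_))
  · calc _ ≤ (K * |s - t|) * L :=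
          mul_le_mul (hK' s hs t ht) (hL s hs) (norm_nonneg _) (by positivity)
      _ = _ := by ring
  · calc _ ≤ K * (L * |s - t|) :=
          mul_le_mul (hK t ht) (hL' s hs t ht) (norm_nonneg _) (by positivity)
      _ = _ := by ring

theorem continuousOn {f : ℝ → E} (hf : LipFamily f) : ContinuousOn f (Icc 0 1) := by
  obtain ⟨K, h0, -, hK'⟩ := hf
  refine (LipschitzOnWith.of_dist_le_mul (K := ⟨K, h0⟩) fun s hs t ht => ?_).continuousOn
  rw [dist_eq_norm, Real.dist_eq]
  exact hK' s hs t ht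

end Basic

theorem clm_comp {E F G : Type*} [NormedAddCommGroup E] [NormedSpace ℂ E] [NormedAddCommGroup F]
    [NormedSpace ℂ F] [NormedAddCommGroup G] [NormedSpace ℂ G] {f : ℝ → F →L[ℂ] G}
    {g : ℝ → E →L[ℂ] F} (hf : LipFamily f) (hg : LipFamily g) :
    LipFamily fun s => f s ∘L g s :=
  bilinear (fun x y => x ∘L y) (fun x y => x.opNorm_comp_le y)
    (fun x x' y => ContinuousLinearMap.sub_comp x x' y)
    (fun x y y' => ContinuousLinearMap.comp_sub x y y') hf hg

theorem mul {R : Type*} [NormedRing R] {f g : ℝ → R} (hf : LipFamily f) (hg : LipFamily g) :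
    LipFamily fun s => f s * g s :=
  bilinear (fun x y => x * y) norm_mul_le sub_mul mul_sub hf hg

theorem star {H : Type*} [NormedAddCommGroup H] [InnerProductSpace ℂ H] [CompleteSpace H]
    {f : ℝ → H →L[ℂ] H} (hf : LipFamily f) : LipFamily fun s => Star.star (f s) := by
  obtain ⟨K, h0, hK, hK'⟩ := hf
  refine ⟨K, h0, fun s hs => by rw [norm_star]; exact hK s hs, fun s hs t ht => ?_⟩
  rw [← star_sub, norm_star]
  exact hK' s hs t ht

theorem of_contDiffOn {E : Type*} [NormedAddCommGroup E] [NormedSpace ℝ E] {f : ℝ → E}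
    (hf : ContDiffOn ℝ 1 f (Icc 0 1)) : LipFamily f := by
  have hu : UniqueDiffOn ℝ (Icc (0 : ℝ) 1) := uniqueDiffOn_Icc zero_lt_one
  obtain ⟨C, hC⟩ := isCompact_Icc.exists_bound_of_continuousOn
    (hf.continuousOn_derivWithin hu le_rfl)
  refine of_lipschitz (B := C) fun s hs t ht => ?_
  exact (convex_Icc 0 1).norm_image_sub_le_of_norm_hasDerivWithin_le
    (fun x hx => (hf.differentiableOn one_ne_zero x hx).hasDerivWithinAt) hC ht hs

end LipFamily

/-- A strongly Lipschitz family of operators is Lipschitz in norm, by uniform boundedness. -/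
theorem LipFamily.of_strong {E F : Type*} [NormedAddCommGroup E] [NormedSpace ℂ E]
    [CompleteSpace E] [NormedAddCommGroup F] [NormedSpace ℂ F] {f : ℝ → E →L[ℂ] F}
    (hf : ∀ x, LipFamily fun s => f s x) : LipFamily f := by
  -- Uniform boundedness is applied to all difference quotients at once.
  let ι := {p : ℝ × ℝ // p.1 ∈ Icc (0 : ℝ) 1 ∧ p.2 ∈ Icc (0 : ℝ) 1 ∧ p.1 ≠ p.2}
  let g : ι → E →L[ℂ] F := fun p => ((|p.1.1 - p.1.2|⁻¹ : ℝ) : ℂ) • (f p.1.1 - f p.1.2)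
  obtain ⟨C, hC⟩ := banach_steinhaus (g := g) fun x => by
    obtain ⟨K, -, -, hK⟩ := hf x
    refine ⟨K, fun p => ?_⟩
    have hp : 0 < |p.1.1 - p.1.2| := abs_pos.2 (sub_ne_zero.2 p.2.2.2)
    rw [_root_.smul_apply, norm_smul, Complex.norm_real, norm_inv, Real.norm_eq_abs,
      abs_abs, inv_mul_le_iff₀ hp, mul_comm]
    exact hK _ p.2.1 _ p.2.2.1
  refine LipFamily.of_lipschitz (B := C) fun s hs t ht => ?_
  rcases eq_or_ne s t with rfl | hst
  · simp
  have hp : 0 < |s - t| := abs_pos.2 (sub_ne_zero.2 hst)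
  have h := hC ⟨(s, t), hs, ht, hst⟩
  rwa [norm_smul, Complex.norm_real, norm_inv, Real.norm_eq_abs, abs_abs, inv_mul_le_iff₀ hp,
    mul_comm] at h

/-! ### Mean value estimates and the growth of energies -/

/-- A continuous function whose right difference quotients are locally at most `K` in norm, up to
arbitrarily small errors, has variation at most `K` on `[0,1]`. -/
theorem norm_sub_le_of_eventually_norm_sub_le {E : Type*} [NormedAddCommGroup E]
    {f : ℝ → E} {K : ℝ} (hf : ContinuousOn f (Icc 0 1))
    (h : ∀ s ∈ Ico (0 : ℝ) 1, ∀ ε > 0, ∀ᶠ r in 𝓝[>] s, ‖f r - f s‖ ≤ (K + ε) * (r - s)) :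
    ∀ s ∈ Icc (0 : ℝ) 1, ‖f s - f 0‖ ≤ K * s := by
  intro s hs
  refine le_of_forall_pos_le_add fun ε hε => ?_
  have := image_norm_le_of_liminf_right_slope_norm_lt_deriv_boundary (a := 0) (b := 1)
    (f := fun r => f r - f 0) (f' := fun _ => K) (hf.sub continuousOn_const) ?_
    (B := fun r => (K + ε) * r) (B' := fun _ => K + ε) (by simp) (by fun_prop)
    (fun x _ => by simpa using ((hasDerivAt_id x).const_mul (K + ε)).hasDerivWithinAt)
    (fun x _ _ => by linarith) hs
  · refine this.trans ?_
    nlinarith [hs.1, hs.2]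
  · intro x hx r hr
    refine Eventually.frequently ?_
    -- Half of the excess `r - K` is spent on the error, so the slope stays strictly below `r`.
    filter_upwards [h x hx ((r - K) / 2) (by linarith), self_mem_nhdsWithin] with z hz hxz
    have hxz' : 0 < z - x := sub_pos.2 hxz
    rw [slope_def_field, div_lt_iff₀ hxz', Function.comp, Function.comp]
    have h3 : ‖f z - f 0‖ - ‖f x - f 0‖ ≤ ‖f z - f x‖ := by
      simpa using norm_sub_norm_le (f z - f 0) (f x - f 0)
    nlinarith

/-- Lipschitz estimate from a bound on the derivative off a finite set. -/
theorem abs_sub_le_of_deriv_le_off_finite {f : ℝ → ℝ} {C : ℝ} {N : Set ℝ} (hN : N.Finite)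
    (hf : ContinuousOn f (Icc 0 1))
    (hd : ∀ s ∈ Icc (0 : ℝ) 1 \ N, ∃ f', HasDerivWithinAt f f' (Icc 0 1) s ∧ |f'| ≤ C) :
    ∀ s ∈ Icc (0 : ℝ) 1, ∀ t ∈ Icc (0 : ℝ) 1, |f s - f t| ≤ C * |s - t| := by
  intro s hs t ht
  have hsub : uIcc t s ⊆ Icc (0 : ℝ) 1 := uIcc_subset_Icc ht hs
  have key : ∀ x ∈ Ioo (min t s) (max t s) \ N, HasDerivAt f (deriv f x) x ∧ |deriv f x| ≤ C := by
    intro x hx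
    have hx1 : x ∈ Ioo (0 : ℝ) 1 :=
      ⟨(le_min ht.1 hs.1).trans_lt hx.1.1, hx.1.2.trans_le (max_le ht.2 hs.2)⟩
    obtain ⟨f', h1, h2⟩ := hd x ⟨Ioo_subset_Icc_self hx1, hx.2⟩
    have h3 := h1.hasDerivAt (Icc_mem_nhds hx1.1 hx1.2)
    rw [h3.deriv]
    exact ⟨h3, h2⟩
  have hae : ∀ᵐ x, x ∈ uIoc t s → ‖deriv f x‖ ≤ C := by
    -- `uIoc` contains its right endpoint, where a two-sided derivative may fail to exist; this one
    -- point is discarded with `N`.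
    have h1 : ∀ᵐ x : ℝ, x ∉ insert (max t s) N :=
      measure_eq_zero_iff_ae_notMem.1 ((hN.insert _).measure_zero _)
    filter_upwards [h1] with x hx hxm
    rw [mem_insert_iff, not_or] at hx
    exact (key x ⟨⟨hxm.1, lt_of_le_of_ne hxm.2 hx.1⟩, hx.2⟩).2
  have hint : IntervalIntegrable (deriv f) volume t s := by
    rw [intervalIntegrable_iff]
    refine Measure.integrableOn_of_bounded (M := C) (by simp)
      (measurable_deriv f).aestronglyMeasurable ?_
    exact (ae_restrict_iff' measurableSet_uIoc).2 hae
  have hI := MeasureTheory.integral_eq_of_hasDerivAt_off_countable f (deriv f)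
    hN.countable (hf.mono hsub) (fun x hx => (key x hx).1) hint
  rw [← hI]
  exact intervalIntegral.norm_integral_le_of_norm_le_const_ae hae

/-- Levels that change at a bounded relative rate. -/
theorem exists_abs_sub_le_of_relative_rate {ι : Type*} {e : ι → ℝ → ℝ} {L : ℝ} {A : Set ι}
    (he : ∀ k ∈ A, ContinuousOn (e k) (Icc 0 1) ∧
      ∃ N : Set ℝ, N.Finite ∧ ∀ s ∈ Icc (0 : ℝ) 1 \ N, ∃ e' : ℝ,
        HasDerivWithinAt (e k) e' (Icc 0 1) s ∧ |e'| ≤ L * (1 + |e k s|)) :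
    ∃ K : ℝ, 0 ≤ K ∧ ∀ k ∈ A, ∀ s ∈ Icc (0 : ℝ) 1, ∀ t ∈ Icc (0 : ℝ) 1,
      |e k s - e k t| ≤ K * (1 + |e k t|) * |s - t| := by
  have hsqrt : ∀ x : ℝ, 1 + |x| ≤ 2 * √(1 + x ^ 2) := fun x => by
    have h1 : (1 : ℝ) ≤ √(1 + x ^ 2) := Real.one_le_sqrt.2 (by nlinarith [sq_nonneg x])
    have h2 : |x| ≤ √(1 + x ^ 2) := Real.abs_le_sqrt (by linarith)
    linarith
  -- `arsinh` has derivative `(1 + x²)^(-1/2)`, so it converts a bounded relative rate into a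
  -- bounded rate. The mean value theorem for `sinh` then converts back.
  have hlip : ∀ k ∈ A, ∀ s ∈ Icc (0 : ℝ) 1, ∀ t ∈ Icc (0 : ℝ) 1,
      |Real.arsinh (e k s) - Real.arsinh (e k t)| ≤ (2 * |L|) * |s - t| := by
    intro k hk
    obtain ⟨hc, N, hN, hd⟩ := he k hk
    refine abs_sub_le_of_deriv_le_off_finite hN (Real.continuous_arsinh.comp_continuousOn hc)
      fun s hs => ?_
    obtain ⟨e', h1, h2⟩ := hd s hs
    refine ⟨_, h1.arsinh, ?_⟩
    have hp : 0 < √(1 + e k s ^ 2) := Real.sqrt_pos.2 (by positivity)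
    rw [smul_eq_mul, abs_mul, abs_inv, abs_of_pos hp, inv_mul_le_iff₀ hp]
    have h3 : L * (1 + |e k s|) ≤ |L| * (1 + |e k s|) :=
      mul_le_mul_of_nonneg_right (le_abs_self L) (by positivity)
    nlinarith [hsqrt (e k s), abs_nonneg L]
  have hcosh : ∀ a b : ℝ, |Real.sinh a - Real.sinh b| ≤
      Real.exp |a - b| * (2 * (1 + |Real.sinh b|)) * |a - b| := by
    intro a b
    have hc : ∀ x ∈ uIcc b a, ‖Real.cosh x‖ ≤ Real.exp |a - b| * (2 * (1 + |Real.sinh b|)) := by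
      intro x hx
      have hxb : |x - b| ≤ |a - b| := by
        have := abs_sub_left_of_mem_uIcc hx
        simpa [abs_sub_comm] using this
      have e1 : Real.cosh x ≤ Real.exp |x - b| * Real.cosh b := by
        have h1 := Real.exp_le_exp.2 (le_abs_self (x - b))
        have h2 := Real.exp_le_exp.2 (neg_le_abs (x - b))
        rw [Real.cosh_eq, Real.cosh_eq]
        have h3 : Real.exp x = Real.exp (x - b) * Real.exp b := by
          rw [← Real.exp_add]; ring_nf
        have h4 : Real.exp (-x) = Real.exp (-(x - b)) * Real.exp (-b) := by
          rw [← Real.exp_add]; ring_nf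
        rw [h3, h4]
        nlinarith [Real.exp_pos b, Real.exp_pos (-b)]
      have e2 : Real.cosh b ≤ 2 * (1 + |Real.sinh b|) := by
        have h1 := Real.cosh_sq b
        have h2 := Real.cosh_pos b
        nlinarith [sq_abs (Real.sinh b), abs_nonneg (Real.sinh b)]
      rw [Real.norm_eq_abs, abs_of_pos (Real.cosh_pos x)]
      exact e1.trans (mul_le_mul (Real.exp_le_exp.2 hxb) e2 (Real.cosh_pos b).le
        (Real.exp_pos _).le)
    exact (convex_uIcc b a).norm_image_sub_le_of_norm_hasDerivWithin_le
      (fun x _ => (Real.hasDerivAt_sinh x).hasDerivWithinAt) hc left_mem_uIcc right_mem_uIcc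
  refine ⟨Real.exp (2 * |L|) * 2 * (2 * |L|), by positivity, fun k hk s hs t ht => ?_⟩
  have h1 := hcosh (Real.arsinh (e k s)) (Real.arsinh (e k t))
  rw [Real.sinh_arsinh, Real.sinh_arsinh] at h1
  have h2 := hlip k hk s hs t ht
  have h3 : |s - t| ≤ 1 := abs_le.2 ⟨by linarith [hs.1, ht.2], by linarith [hs.2, ht.1]⟩
  have h4 : |Real.arsinh (e k s) - Real.arsinh (e k t)| ≤ 2 * |L| := by
    nlinarith [abs_nonneg L]
  calc _ ≤ _ := h1
    _ ≤ Real.exp (2 * |L|) * (2 * (1 + |e k t|)) * (2 * |L| * |s - t|) := by gcongr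
    _ = _ := by ring

/-! ### Cut-off functions of the energy -/

/-- Truncation to `[-h, h]`. -/
def clampAt (h x : ℝ) : ℝ := max (-h) (min h x)

theorem abs_clampAt_le {h : ℝ} (hh : 0 ≤ h) (x : ℝ) : |clampAt h x| ≤ h :=
  abs_le.2 ⟨le_max_left _ _, max_le (by linarith) (min_le_left _ _)⟩

theorem clampAt_of_abs_le {h x : ℝ} (hx : |x| ≤ h) : clampAt h x = x := by
  rw [clampAt, min_eq_right (abs_le.1 hx).2, max_eq_right (abs_le.1 hx).1]

theorem abs_clampAt_sub_le (h x y : ℝ) : |clampAt h x - clampAt h y| ≤ |x - y| := by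
  refine (abs_max_sub_max_le_max _ _ _ _).trans ?_
  rw [sub_self, abs_zero]
  refine max_le (abs_nonneg _) ((abs_min_sub_min_le_max _ _ _ _).trans ?_)
  rw [sub_self, abs_zero]
  exact max_le (abs_nonneg _) le_rfl

theorem measurable_clampAt (h : ℝ) : Measurable (clampAt h) :=
  measurable_const.max (measurable_const.min measurable_id)

/-- The inverse `x⁻¹`, continued linearly to `[-d, d]`. -/
def cutInv (d x : ℝ) : ℝ := if |x| ≤ d then x / d ^ 2 else x⁻¹

theorem measurable_cutInv (d : ℝ) : Measurable (cutInv d) :=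
  Measurable.ite (measurableSet_le measurable_norm measurable_const) (measurable_id.div_const _)
    measurable_inv

theorem abs_cutInv_le {d : ℝ} (hd : 0 < d) (x : ℝ) : |cutInv d x| ≤ 1 / d := by
  unfold cutInv
  split_ifs with h
  · rw [abs_div, abs_of_pos (pow_pos hd 2), div_le_div_iff₀ (by positivity) hd]
    nlinarith
  · rw [abs_inv, inv_eq_one_div]
    exact one_div_le_one_div_of_le hd (not_le.1 h).le

theorem cutInv_mul_self {d x : ℝ} (hd : 0 < d) (hx : d ≤ |x|) : cutInv d x * x = 1 := by
  have hx0 : x ≠ 0 := abs_pos.1 (hd.trans_le hx)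
  unfold cutInv
  split_ifs with h
  · have : |x| = d := le_antisymm h hx
    rw [← this, sq_abs]
    field_simp
  · exact inv_mul_cancel₀ hx0

/-- The factor `max d |y|` in the denominator is the point: it absorbs the factor `1 + |E|` in the
variation of unbounded energies outside the window. -/
theorem abs_cutInv_sub_le {d : ℝ} (hd : 0 < d) (x y : ℝ) :
    |cutInv d x - cutInv d y| ≤ |x - y| / (d * max d |y|) := by
  have mixed : ∀ a b : ℝ, |a| ≤ d → d < |b| → |a / d ^ 2 - b⁻¹| ≤ |a - b| / (d * |b|) := by
    intro a b ha hb
    have hb0 : 0 < |b| := hd.trans hb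
    have e : a / d ^ 2 - b⁻¹ = (a * b - d ^ 2) / (d ^ 2 * b) := by
      have := abs_pos.1 hb0
      field_simp
    -- Indeed `d² (a - b)² - (a b - d²)² = (d² - a²) (b² - d²) ≥ 0`.
    have h1 : |a * b - d ^ 2| ≤ d * |a - b| := by
      rw [← abs_of_pos hd, ← abs_mul, abs_of_pos hd]
      refine sq_le_sq.1 ?_
      have h2 : a ^ 2 ≤ d ^ 2 := sq_le_sq.2 (by rwa [abs_of_pos hd])
      have h3 : d ^ 2 ≤ b ^ 2 := sq_le_sq.2 (by rw [abs_of_pos hd]; exact hb.le)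
      nlinarith [mul_nonneg (sub_nonneg.2 h2) (sub_nonneg.2 h3)]
    rw [e, abs_div, abs_mul, abs_of_pos (pow_pos hd 2), div_le_div_iff₀ (by positivity)
      (by positivity)]
    nlinarith [mul_le_mul_of_nonneg_right h1 (mul_pos hd hb0).le]
  unfold cutInv
  split_ifs with hx hy hy
  · rw [← sub_div, abs_div, abs_of_pos (pow_pos hd 2), max_eq_left hy, sq]
  · rw [max_eq_right (not_le.1 hy).le]
    exact mixed x y hx (not_le.1 hy)
  · rw [max_eq_left hy, abs_sub_comm, abs_sub_comm x y]
    refine (mixed y x hy (not_le.1 hx)).trans ?_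
    have := (not_le.1 hx).le
    gcongr
  · have hx' := (not_le.1 hx)
    have hy' := (not_le.1 hy)
    have hx0 := abs_pos.1 (hd.trans hx')
    have hy0 := abs_pos.1 (hd.trans hy')
    rw [max_eq_right hy'.le, inv_sub_inv hx0 hy0, abs_div, abs_mul, abs_sub_comm]
    gcongr

/-- The ramp `x ↦ min (max x 0) 1`. -/
def ramp (x : ℝ) : ℝ := max 0 (min 1 x)

theorem measurable_ramp : Measurable ramp :=
  measurable_const.max (measurable_const.min measurable_id)

theorem ramp_of_nonpos {x : ℝ} (hx : x ≤ 0) : ramp x = 0 :=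
  max_eq_left ((min_le_right _ _).trans hx)

theorem ramp_of_one_le {x : ℝ} (hx : 1 ≤ x) : ramp x = 1 := by
  rw [ramp, min_eq_left hx, max_eq_right zero_le_one]

theorem ramp_mem (x : ℝ) : 0 ≤ ramp x ∧ ramp x ≤ 1 :=
  ⟨le_max_left _ _, max_le zero_le_one (min_le_left _ _)⟩

theorem abs_ramp_sub_le (x y : ℝ) : |ramp x - ramp y| ≤ |x - y| := by
  refine (abs_max_sub_max_le_max _ _ _ _).trans ?_
  rw [sub_self, abs_zero]
  refine max_le (abs_nonneg _) ((abs_min_sub_min_le_max _ _ _ _).trans ?_)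
  rw [sub_self, abs_zero]
  exact max_le (abs_nonneg _) le_rfl

/-- The hat function of width `h` centered at `c`. -/
def hat (h c x : ℝ) : ℝ := ramp ((x - c) / h + 1) - ramp ((x - c) / h)

theorem measurable_hat (h c : ℝ) : Measurable (hat h c) := by
  have h1 : Measurable fun x : ℝ => (x - c) / h := by fun_prop
  exact (measurable_ramp.comp (h1.add_const 1)).sub (measurable_ramp.comp h1)

theorem abs_hat_le (h c x : ℝ) : |hat h c x| ≤ 1 := by
  have h1 := ramp_mem ((x - c) / h + 1)
  have h2 := ramp_mem ((x - c) / h)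
  exact abs_le.2 ⟨by rw [hat]; linarith, by rw [hat]; linarith⟩

theorem abs_sub_le_of_hat_ne_zero {h c x : ℝ} (hh : 0 < h) (hx : hat h c x ≠ 0) :
    |x - c| ≤ h := by
  contrapose! hx
  rw [hat]
  rcases lt_abs.1 hx with hx | hx
  · have h1 : 1 ≤ (x - c) / h := (one_le_div hh).2 hx.le
    rw [ramp_of_one_le h1, ramp_of_one_le (by linarith), sub_self]
  · have h1 : (x - c) / h ≤ -1 := by rw [div_le_iff₀ hh]; linarith
    rw [ramp_of_nonpos (by linarith), ramp_of_nonpos (by linarith), sub_self]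

theorem abs_hat_sub_le {h : ℝ} (hh : 0 < h) (c x y : ℝ) :
    |hat h c x - hat h c y| ≤ 2 / h * |x - y| := by
  have e : ∀ b : ℝ, |((x - c) / h + b) - ((y - c) / h + b)| = |x - y| / h := fun b => by
    rw [add_sub_add_right_eq_sub, ← sub_div, sub_sub_sub_cancel_right, abs_div, abs_of_pos hh]
  have h1 := abs_ramp_sub_le ((x - c) / h + 1) ((y - c) / h + 1)
  have h2 := abs_ramp_sub_le ((x - c) / h + 0) ((y - c) / h + 0)
  rw [e] at h1 h2
  simp only [add_zero] at h2
  have h3 : hat h c x - hat h c y =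
      (ramp ((x - c) / h + 1) - ramp ((y - c) / h + 1)) -
        (ramp ((x - c) / h) - ramp ((y - c) / h)) := by
    rw [hat, hat]; ring
  rw [h3]
  calc _ ≤ _ := abs_sub _ _
    _ ≤ |x - y| / h + |x - y| / h := add_le_add h1 h2
    _ = _ := by ring

/-- Finitely many hat functions form a partition of unity on a bounded interval. -/
theorem exists_sum_hat_eq_one {h : ℝ} (hh : 0 < h) (M : ℝ) :
    ∃ u : ℕ, ∀ x, |x| ≤ M → ∑ n ∈ Finset.range u, hat h (-M + n * h) x = 1 := by
  obtain ⟨u, hu⟩ := exists_nat_ge (2 * M / h + 1)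
  refine ⟨u, fun x hx => ?_⟩
  obtain ⟨hx1, hx2⟩ := abs_le.1 hx
  -- Consecutive hats are differences of one shifted ramp, so the sum telescopes.
  have e : ∀ n : ℕ, hat h (-M + n * h) x =
      ramp ((x + M) / h + 1 - n) - ramp ((x + M) / h + 1 - (n + 1 : ℕ)) := fun n => by
    have e1 : (x - (-M + n * h)) / h = (x + M) / h - n := by field_simp; ring
    rw [hat, e1]
    congr 2 <;> push_cast <;> ring
  simp_rw [e]
  rw [Finset.sum_range_sub', ramp_of_one_le, ramp_of_nonpos, sub_zero]
  · have : (x + M) / h ≤ 2 * M / h := by gcongr; linarith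
    linarith
  · have : 0 ≤ (x + M) / h := div_nonneg (by linarith) hh.le
    simpa using this

/-! ### Multiplication operators on amplitudes -/

/-- Bounded measurable functions of the label. -/
def IsMultiplier (m : ℝ → ℝ) : Prop := Measurable m ∧ ∃ C : ℝ, ∀ k, |m k| ≤ C

theorem IsMultiplier.memLp {Ω : Set ℝ} {m : ℝ → ℝ} (hm : IsMultiplier m) (f : Amplitude Ω) :
    MemLp (fun k => (m k : ℂ) * f k) 2 (volume.restrict Ω) := by
  obtain ⟨hm, C, hC⟩ := hm
  refine (Lp.memLp f).of_le_mul (c := C)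
    ((Complex.measurable_ofReal.comp hm).aestronglyMeasurable.mul
      (Lp.aestronglyMeasurable f)) (ae_of_all _ fun k => ?_)
  rw [norm_mul, Complex.norm_real]
  exact mul_le_mul_of_nonneg_right (hC k) (norm_nonneg _)

theorem IsMultiplier.indicator {m : ℝ → ℝ} (hm : IsMultiplier m) {W : Set ℝ}
    (hW : MeasurableSet W) : IsMultiplier (W.indicator m) := by
  obtain ⟨hm, C, hC⟩ := hm
  refine ⟨hm.indicator hW, C, fun k => ?_⟩
  rw [← Real.norm_eq_abs]
  exact (norm_indicator_le_norm_self m k).trans (hC k)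

theorem isMultiplier_one : IsMultiplier 1 :=
  ⟨measurable_const, 1, fun k => by simp⟩

theorem IsMultiplier.mul {m n : ℝ → ℝ} (hm : IsMultiplier m) (hn : IsMultiplier n) :
    IsMultiplier (m * n) := by
  obtain ⟨hm, C, hC⟩ := hm
  obtain ⟨hn, D, hD⟩ := hn
  refine ⟨hm.mul hn, C * D, fun k => ?_⟩
  rw [Pi.mul_apply, abs_mul]
  exact mul_le_mul (hC k) (hD k) (abs_nonneg _) ((abs_nonneg _).trans (hC k))

theorem exists_boundedMul (Ω : Set ℝ) {m : ℝ → ℝ} (hm : IsMultiplier m) :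
    ∃ A : Amplitude Ω →L[ℂ] Amplitude Ω,
      ∀ f, A f =ᵐ[volume.restrict Ω] fun k => (m k : ℂ) * f k := by
  obtain ⟨C, hC⟩ := hm.2
  let A : Amplitude Ω →ₗ[ℂ] Amplitude Ω :=
    { toFun := fun f => (hm.memLp f).toLp _
      map_add' := fun f g => by
        rw [← MemLp.toLp_add, MemLp.toLp_eq_toLp_iff]
        filter_upwards [Lp.coeFn_add f g] with x hx
        rw [hx, Pi.add_apply, Pi.add_apply, mul_add]
      map_smul' := fun c f => by
        rw [← MemLp.toLp_const_smul, MemLp.toLp_eq_toLp_iff]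
        filter_upwards [Lp.coeFn_smul c f] with x hx
        rw [hx, Pi.smul_apply, Pi.smul_apply, smul_eq_mul, smul_eq_mul, mul_left_comm,
          RingHom.id_apply] }
  refine ⟨A.mkContinuous C fun f => Lp.norm_le_mul_norm_of_ae_le_mul ?_, fun f =>
    (hm.memLp f).coeFn_toLp⟩
  filter_upwards [(hm.memLp f).coeFn_toLp] with k hk
  refine (congrArg norm hk).trans_le ?_
  rw [norm_mul, Complex.norm_real]
  exact mul_le_mul_of_nonneg_right (hC k) (norm_nonneg _)

open Classical in
/-- Multiplication by a bounded measurable function (zero for other functions). -/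
def boundedMul (Ω : Set ℝ) (m : ℝ → ℝ) : Amplitude Ω →L[ℂ] Amplitude Ω :=
  if h : IsMultiplier m then (exists_boundedMul Ω h).choose else 0

section

variable {Ω : Set ℝ} {m n : ℝ → ℝ}

theorem coeFn_boundedMul (hm : IsMultiplier m) (f : Amplitude Ω) :
    boundedMul Ω m f =ᵐ[volume.restrict Ω] fun k => (m k : ℂ) * f k := by
  rw [boundedMul, dif_pos hm]
  exact (exists_boundedMul Ω hm).choose_spec f

theorem norm_boundedMul_le (hΩ : MeasurableSet Ω) (hm : IsMultiplier m) {C : ℝ} (hC0 : 0 ≤ C)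
    (hC : ∀ k ∈ Ω, |m k| ≤ C) : ‖boundedMul Ω m‖ ≤ C := by
  refine ContinuousLinearMap.opNorm_le_bound _ hC0 fun f => Lp.norm_le_mul_norm_of_ae_le_mul ?_
  filter_upwards [coeFn_boundedMul hm f, ae_restrict_mem hΩ] with k hk hkΩ
  rw [hk, norm_mul, Complex.norm_real]
  exact mul_le_mul_of_nonneg_right (hC k hkΩ) (norm_nonneg _)

theorem norm_boundedMul_sub_le (hΩ : MeasurableSet Ω) (hm : IsMultiplier m)
    (hn : IsMultiplier n) {C : ℝ} (hC0 : 0 ≤ C) (hC : ∀ k ∈ Ω, |m k - n k| ≤ C) :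
    ‖boundedMul Ω m - boundedMul Ω n‖ ≤ C := by
  refine ContinuousLinearMap.opNorm_le_bound _ hC0 fun f => Lp.norm_le_mul_norm_of_ae_le_mul ?_
  rw [_root_.sub_apply]
  filter_upwards [coeFn_boundedMul hm f, coeFn_boundedMul hn f, ae_restrict_mem hΩ,
    Lp.coeFn_sub (boundedMul Ω m f) (boundedMul Ω n f)] with k hk hk' hkΩ h
  rw [h, Pi.sub_apply, hk, hk', ← sub_mul, norm_mul, ← Complex.ofReal_sub, Complex.norm_real]
  exact mul_le_mul_of_nonneg_right (hC k hkΩ) (norm_nonneg _)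

theorem boundedMul_congr (hΩ : MeasurableSet Ω) (hm : IsMultiplier m)
    (hn : IsMultiplier n) (h : ∀ k ∈ Ω, m k = n k) : boundedMul Ω m = boundedMul Ω n := by
  have := norm_boundedMul_sub_le hΩ hm hn le_rfl fun k hk => by rw [h k hk, sub_self, abs_zero]
  exact sub_eq_zero.1 (norm_le_zero_iff.1 this)

theorem boundedMul_mul (hm : IsMultiplier m) (hn : IsMultiplier n) :
    boundedMul Ω m * boundedMul Ω n = boundedMul Ω (m * n) := by
  ext1 f
  refine Lp.ext ?_
  rw [mul_apply_eq_comp]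
  filter_upwards [coeFn_boundedMul hm (boundedMul Ω n f), coeFn_boundedMul hn f,
    coeFn_boundedMul (hm.mul hn) f] with k h1 h2 h3
  rw [h1, h2, h3, Pi.mul_apply, Complex.ofReal_mul, mul_assoc]

theorem boundedMul_sum {ι : Type*} (u : Finset ι) {m : ι → ℝ → ℝ} (hm : ∀ i, IsMultiplier (m i))
    (hs : IsMultiplier (fun k => ∑ i ∈ u, m i k)) :
    ∑ i ∈ u, boundedMul Ω (m i) = boundedMul Ω fun k => ∑ i ∈ u, m i k := by
  ext1 f
  refine Lp.ext ?_
  rw [_root_.sum_apply]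
  have h1 := Lp.coeFn_finsetSum u fun i => boundedMul Ω (m i) f
  have h2 : ∀ᵐ k ∂(volume.restrict Ω), ∀ i ∈ u, boundedMul Ω (m i) f k = (m i k : ℂ) * f k :=
    (ae_ball_iff u.countable_toSet).2 fun i _ => coeFn_boundedMul (hm i) f
  filter_upwards [h1, h2, coeFn_boundedMul hs f] with k h1 h2 h3
  rw [h1, h3, Complex.ofReal_sum, Finset.sum_mul, Finset.sum_apply]
  exact Finset.sum_congr rfl h2

theorem inner_boundedMul (hm : IsMultiplier m) (f g : Amplitude Ω) :
    inner ℂ (boundedMul Ω m f) g = inner ℂ f (boundedMul Ω m g) := by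
  rw [L2.inner_def, L2.inner_def]
  refine integral_congr_ae ?_
  filter_upwards [coeFn_boundedMul hm f, coeFn_boundedMul hm g] with k h1 h2
  simp only [h1, h2, RCLike.inner_apply, map_mul, Complex.conj_ofReal]
  ring

theorem cutoff_eq_boundedMul {J : Set ℝ} (hJ : MeasurableSet J) :
    cutoff Ω J hJ = boundedMul Ω (J.indicator 1) := by
  ext1 f
  refine Lp.ext ?_
  filter_upwards [coeFn_cutoffLinear Ω J hJ f,
    coeFn_boundedMul (isMultiplier_one.indicator hJ) f] with k h1 h2
  rw [h2]
  refine h1.trans ?_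
  by_cases hk : k ∈ J <;> simp [hk]

variable {e : ℝ → ℝ}

theorem coeFn_mulOperator (f : (mulOperator Ω e).domain) :
    mulOperator Ω e f =ᵐ[volume.restrict Ω] fun k => (e k : ℂ) * (f : Amplitude Ω) k :=
  MemLp.coeFn_toLp f.2

/-- If `m (e - c) = n` on `Ω`, then multiplication by `m` after `e - c` is multiplication by
`n`. -/
theorem boundedMul_mulOperator_sub (hΩ : MeasurableSet Ω) (hm : IsMultiplier m)
    (hn : IsMultiplier n) {c : ℝ} (h : ∀ k ∈ Ω, m k * (e k - c) = n k)
    (f : (mulOperator Ω e).domain) :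
    boundedMul Ω m (mulOperator Ω e f - (c : ℂ) • (f : Amplitude Ω)) = boundedMul Ω n f := by
  refine Lp.ext ?_
  filter_upwards [coeFn_boundedMul hm (mulOperator Ω e f - (c : ℂ) • (f : Amplitude Ω)),
    coeFn_boundedMul hn (f : Amplitude Ω), coeFn_mulOperator f,
    Lp.coeFn_sub (mulOperator Ω e f) ((c : ℂ) • (f : Amplitude Ω)),
    Lp.coeFn_smul (c : ℂ) (f : Amplitude Ω), ae_restrict_mem hΩ] with k h1 h2 h3 h4 h5 hk
  rw [h1, h2, h4, Pi.sub_apply, h3, h5, Pi.smul_apply, smul_eq_mul, ← h k hk]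
  push_cast
  ring

/-- Multiplication operators commute with `e`, weakly on the domain of `e`. -/
theorem inner_mulOperator_boundedMul (hm : IsMultiplier m) (f g : (mulOperator Ω e).domain) :
    inner ℂ (mulOperator Ω e f) (boundedMul Ω m (g : Amplitude Ω)) =
      inner ℂ (f : Amplitude Ω) (boundedMul Ω m (mulOperator Ω e g)) := by
  rw [L2.inner_def, L2.inner_def]
  refine integral_congr_ae ?_
  filter_upwards [coeFn_boundedMul hm (g : Amplitude Ω), coeFn_mulOperator f,
    coeFn_boundedMul hm (mulOperator Ω e g), coeFn_mulOperator g] with k h1 h2 h3 h4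
  simp only [h1, h2, h3, h4, RCLike.inner_apply, map_mul, Complex.conj_ofReal]
  ring

/-- The maximal domain of multiplication by a measurable function is dense. -/
theorem dense_mulOperator_domain (he : Measurable e) :
    Dense ((mulOperator Ω e).domain : Set (Amplitude Ω)) := by
  rw [Submodule.dense_iff_topologicalClosure_eq_top, Submodule.topologicalClosure_eq_top_iff,
    Submodule.eq_bot_iff]
  intro f hf
  have hJ : ∀ n : ℕ, MeasurableSet {k | |e k| ≤ n} := fun n =>
    measurableSet_le he.norm measurable_const
  have hm : ∀ n : ℕ, IsMultiplier ({k | |e k| ≤ n}.indicator 1) := fun n =>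
    isMultiplier_one.indicator (hJ n)
  -- The truncation of `f` to `|e| ≤ n` lies in the domain, so it is orthogonal to `f`; their inner
  -- product is its squared norm.
  have hz : ∀ n : ℕ, boundedMul Ω ({k | |e k| ≤ n}.indicator 1) f = 0 := by
    intro n
    have hmem : boundedMul Ω ({k | |e k| ≤ n}.indicator 1) f ∈ (mulOperator Ω e).domain := by
      have hp : IsMultiplier ({k | |e k| ≤ n}.indicator e) := by
        refine ⟨he.indicator (hJ n), n, fun k => ?_⟩
        by_cases hk : |e k| ≤ n
        · rwa [indicator_of_mem (by exact hk)]
        · rw [indicator_of_notMem (by exact hk)]; simp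
      refine (memLp_congr_ae ?_).1 (hp.memLp f)
      filter_upwards [coeFn_boundedMul (hm n) f] with k hk
      rw [hk]
      by_cases hk : |e k| ≤ n
      · rw [indicator_of_mem (by exact hk), indicator_of_mem (by exact hk)]; simp
      · rw [indicator_of_notMem (by exact hk), indicator_of_notMem (by exact hk)]; simp
    have h0 := (Submodule.mem_orthogonal _ _).1 hf _ hmem
    have h1 : ({k | |e k| ≤ n}.indicator 1 : ℝ → ℝ) * {k | |e k| ≤ n}.indicator 1 =
        {k | |e k| ≤ n}.indicator 1 := by
      ext k
      by_cases hk : |e k| ≤ n <;> simp [indicator, hk]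
    have h2 := congrArg (fun A : Amplitude Ω →L[ℂ] Amplitude Ω => A f)
      (boundedMul_mul (Ω := Ω) (hm n) (hm n))
    simp only [h1, mul_apply_eq_comp] at h2
    rw [← h2, inner_boundedMul (hm n)] at h0
    exact inner_self_eq_zero.1 h0
  refine Lp.eq_zero_iff_ae_eq_zero.2 ?_
  have h1 : ∀ᵐ k ∂(volume.restrict Ω), ∀ n : ℕ,
      (({k | |e k| ≤ n}.indicator 1 k : ℝ) : ℂ) * f k = 0 := by
    refine ae_all_iff.2 fun n => ?_
    have h2 := coeFn_boundedMul (hm n) f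
    rw [hz n] at h2
    filter_upwards [h2, Lp.coeFn_zero ℂ 2 (volume.restrict Ω)] with k h3 h4
    rw [← h3, h4, Pi.zero_apply]
  filter_upwards [h1] with k hk
  obtain ⟨n, hn⟩ := exists_nat_ge |e k|
  have := hk n
  rw [indicator_of_mem (by exact hn)] at this
  simpa using this

end

/-! ### The fixed point equation `x = a x z + y` -/

section FixedPoint

variable {R : Type*} [NormedRing R]

/-- The map `x ↦ a x z` has norm at most `1/2`, so `1` minus it is invertible by the Neumann series.
-/
theorem exists_eq_mul_mul_add [NormedAlgebra ℂ R] [CompleteSpace R] {a z : R}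
    (h : ‖a‖ * ‖z‖ ≤ 1 / 2) (y : R) : ∃ x, x = a * x * z + y := by
  have hlt : ‖ContinuousLinearMap.mulLeftRight ℂ R a z‖ < 1 :=
    (ContinuousLinearMap.opNorm_mulLeftRight_apply_apply_le ℂ R a z).trans_lt
      (h.trans_lt (by norm_num))
  obtain ⟨u, hu⟩ := isUnit_one_sub_of_norm_lt_one hlt
  refine ⟨(↑u⁻¹ : R →L[ℂ] R) y, ?_⟩
  have h1 := congrArg (fun A : R →L[ℂ] R => A y) u.mul_inv
  simp only [mul_apply_eq_comp, hu, _root_.sub_apply, one_apply_eq_self,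
    ContinuousLinearMap.mulLeftRight_apply] at h1
  rw [sub_eq_iff_eq_add] at h1
  rw [add_comm]
  exact h1

theorem norm_le_of_eq_mul_mul_add {a z x y : R} (h : ‖a‖ * ‖z‖ ≤ 1 / 2)
    (hx : x = a * x * z + y) : ‖x‖ ≤ 2 * ‖y‖ := by
  have h1 : ‖a * x * z‖ ≤ 1 / 2 * ‖x‖ := by
    calc _ ≤ ‖a‖ * ‖x‖ * ‖z‖ := norm_mul₃_le
      _ = ‖a‖ * ‖z‖ * ‖x‖ := by ring
      _ ≤ _ := by gcongr
  have h2 : ‖x‖ ≤ ‖a * x * z‖ + ‖y‖ := by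
    conv_lhs => rw [hx]
    exact norm_add_le _ _
  linarith

theorem eq_of_eq_mul_mul_add {a z x x' y : R} (h : ‖a‖ * ‖z‖ ≤ 1 / 2)
    (hx : x = a * x * z + y) (hx' : x' = a * x' * z + y) : x = x' := by
  have h1 : x - x' = a * (x - x') * z + 0 := by
    rw [mul_sub, sub_mul, add_zero]
    conv_lhs => rw [hx, hx']
    abel
  have := norm_le_of_eq_mul_mul_add h h1
  rw [norm_zero, mul_zero] at this
  exact sub_eq_zero.1 (norm_le_zero_iff.1 this)

theorem LipFamily.of_eq_mul_mul_add {a z x y : ℝ → R} (ha : LipFamily a) (hz : LipFamily z)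
    (hy : LipFamily y) (h : ∀ s ∈ Icc (0 : ℝ) 1, ‖a s‖ * ‖z s‖ ≤ 1 / 2)
    (hx : ∀ s ∈ Icc (0 : ℝ) 1, x s = a s * x s * z s + y s) : LipFamily x := by
  obtain ⟨A, hA0, hA, hA'⟩ := ha
  obtain ⟨Z, hZ0, hZ, hZ'⟩ := hz
  obtain ⟨Y, hY0, hY, hY'⟩ := hy
  have hX : ∀ s ∈ Icc (0 : ℝ) 1, ‖x s‖ ≤ 2 * Y := fun s hs =>
    (norm_le_of_eq_mul_mul_add (h s hs) (hx s hs)).trans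
      (mul_le_mul_of_nonneg_left (hY s hs) (zero_le_two (α := ℝ)))
  refine LipFamily.of_lipschitz (B := (2 : ℝ) * (A * (2 * Y) * Z + A * (2 * Y) * Z + Y))
    fun s hs t ht => ?_
  -- The increment solves an equation of the same type, whose source contains only increments of the
  -- data.
  have e : x s - x t = a s * (x s - x t) * z s +
      ((a s - a t) * x t * z s + a t * x t * (z s - z t) + (y s - y t)) := by
    conv_lhs => rw [hx s hs, hx t ht]
    noncomm_ring
  refine (norm_le_of_eq_mul_mul_add (h s hs) e).trans ?_
  rw [mul_assoc (2 : ℝ)]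
  refine mul_le_mul_of_nonneg_left ?_ (zero_le_two (α := ℝ))
  have h1 : ‖(a s - a t) * x t * z s‖ ≤ (A * |s - t|) * (2 * Y) * Z := by
    refine norm_mul₃_le.trans ?_
    gcongr
    exacts [hA' s hs t ht, hX t ht, hZ s hs]
  have h2 : ‖a t * x t * (z s - z t)‖ ≤ A * (2 * Y) * (Z * |s - t|) := by
    refine norm_mul₃_le.trans ?_
    gcongr
    exacts [hA t ht, hX t ht, hZ' s hs t ht]
  calc _ ≤ _ := norm_add₃_le
    _ ≤ (A * |s - t|) * (2 * Y) * Z + A * (2 * Y) * (Z * |s - t|) + Y * |s - t| :=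
      add_le_add (add_le_add h1 h2) (hY' s hs t ht)
    _ = _ := by ring

end FixedPoint

/-! ### The Sylvester equation on a short energy interval -/

section Sylvester

variable (Ω W : Set ℝ) (h c : ℝ) (e : ℝ → ℝ)

/-- The energies in the window, measured from `c` and truncated. -/
def innerEnergy (k : ℝ) : ℝ := W.indicator (fun k => clampAt h (e k - c)) k

/-- The inverse energies outside the window, measured from `c`. -/
def outerInverse (k : ℝ) : ℝ := Wᶜ.indicator (fun k => cutInv (2 * h) (e k - c)) k

/-- The part of the window with energies near `c`. -/
def windowHat (k : ℝ) : ℝ := W.indicator (fun k => hat h c (e k)) k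

variable {Ω W h c e}

theorem isMultiplier_innerEnergy (hW : MeasurableSet W) (he : Measurable e) (hh : 0 < h) :
    IsMultiplier (innerEnergy W h c e) :=
  IsMultiplier.indicator ⟨(measurable_clampAt h).comp (he.sub_const c), h,
    fun _ => abs_clampAt_le hh.le _⟩ hW

theorem isMultiplier_outerInverse (hW : MeasurableSet W) (he : Measurable e) (hh : 0 < h) :
    IsMultiplier (outerInverse W h c e) :=
  IsMultiplier.indicator ⟨(measurable_cutInv _).comp (he.sub_const c), 1 / (2 * h),
    fun _ => abs_cutInv_le (by positivity) _⟩ hW.compl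

theorem isMultiplier_windowHat (hW : MeasurableSet W) (he : Measurable e) :
    IsMultiplier (windowHat W h c e) :=
  IsMultiplier.indicator ⟨(measurable_hat h c).comp he, 1, fun _ => abs_hat_le _ _ _⟩ hW

/-- The truncations give `h · 1/(2h)` whatever the energies are. The contraction thus persists at
times when no window level is near `c` and outside levels may cross it. -/
theorem norm_innerEnergy_mul_norm_outerInverse_le (hΩ : MeasurableSet Ω) (hW : MeasurableSet W)
    (he : Measurable e) (hh : 0 < h) :
    ‖boundedMul Ω (innerEnergy W h c e)‖ * ‖boundedMul Ω (outerInverse W h c e)‖ ≤ 1 / 2 := by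
  have h1 : ‖boundedMul Ω (innerEnergy W h c e)‖ ≤ h :=
    norm_boundedMul_le hΩ (isMultiplier_innerEnergy hW he hh) hh.le fun k _ => by
      rw [innerEnergy, ← Real.norm_eq_abs]
      exact (norm_indicator_le_norm_self _ k).trans (abs_clampAt_le hh.le _)
  have h2 : ‖boundedMul Ω (outerInverse W h c e)‖ ≤ 1 / (2 * h) :=
    norm_boundedMul_le hΩ (isMultiplier_outerInverse hW he hh) (by positivity) fun k _ => by
      rw [outerInverse, ← Real.norm_eq_abs]
      exact (norm_indicator_le_norm_self _ k).trans (abs_cutInv_le (by positivity) _)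
  calc _ ≤ h * (1 / (2 * h)) := by gcongr
    _ = 1 / 2 := by field_simp

/-- The weak Sylvester equation `e X - X e = χ Y (1 - 1_W)`, for a part `χ` of the window with
energies in a short interval. -/
theorem weak_commutator_windowHat (hΩ : MeasurableSet Ω) (hW : MeasurableSet W)
    (he : Measurable e) (hh : 0 < h)
    (hgap : ∀ k' ∈ Ω ∩ W, ∀ k'' ∈ Ω \ W, 3 * h ≤ |e k' - e k''|)
    {X Y : Amplitude Ω →L[ℂ] Amplitude Ω}
    (hX : X = boundedMul Ω (innerEnergy W h c e) * X * boundedMul Ω (outerInverse W h c e) +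
      -(boundedMul Ω (windowHat W h c e) * Y * boundedMul Ω (outerInverse W h c e)))
    (f g : (mulOperator Ω e).domain) :
    inner ℂ (mulOperator Ω e f) (X g) - inner ℂ (f : Amplitude Ω) (X (mulOperator Ω e g)) =
      inner ℂ (f : Amplitude Ω)
        ((boundedMul Ω (windowHat W h c e) * Y * boundedMul Ω (Wᶜ.indicator 1)) g) := by
  have hα := isMultiplier_innerEnergy (c := c) hW he hh
  have hζ := isMultiplier_outerInverse (c := c) hW he hh
  have hχ := isMultiplier_windowHat (h := h) (c := c) hW he
  have hn := norm_innerEnergy_mul_norm_outerInverse_le (c := c) hΩ hW he hh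
  have hq : IsMultiplier (Wᶜ.indicator 1) := isMultiplier_one.indicator hW.compl
  -- If no window level is charged by the hat, both sides vanish. Otherwise a level `k₀` within `h`
  -- of `c` keeps the outside levels at distance `3h - h = 2h` from `c`.
  by_cases hχ0 : ∀ k ∈ Ω, windowHat W h c e k = 0
  · have h0 : boundedMul Ω (windowHat W h c e) = 0 := norm_le_zero_iff.1
      (norm_boundedMul_le hΩ hχ le_rfl fun k hk => by rw [hχ0 k hk, abs_zero])
    have hX0 : X = 0 := eq_of_eq_mul_mul_add hn hX (by simp [h0])
    simp [h0, hX0]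
  push Not at hχ0
  obtain ⟨k₀, hk₀, hne⟩ := hχ0
  have hk₀W : k₀ ∈ W := by
    by_contra hk
    exact hne (indicator_of_notMem hk _)
  have hk₀c : |e k₀ - c| ≤ h := by
    rw [windowHat, indicator_of_mem hk₀W] at hne
    exact abs_sub_le_of_hat_ne_zero hh hne
  have hout : ∀ k ∈ Ω \ W, 2 * h ≤ |e k - c| := fun k hk => by
    have h1 := hgap k₀ ⟨hk₀, hk₀W⟩ k hk
    have h2 : |e k₀ - e k| ≤ |e k₀ - c| + |e k - c| := by
      rw [abs_sub_comm (e k)]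
      exact abs_sub_le _ _ _
    linarith
  set α := boundedMul Ω (innerEnergy W h c e) with hαdef
  set ζ := boundedMul Ω (outerInverse W h c e) with hζdef
  set χ := boundedMul Ω (windowHat W h c e) with hχdef
  set Q := boundedMul Ω (Wᶜ.indicator 1) with hQdef
  -- the spectral projection onto the part of the window with energies near `c`
  let J : Set ℝ := W ∩ {k | |e k - c| ≤ h}
  have hJ : MeasurableSet J :=
    hW.inter (measurableSet_le (he.sub_const c).norm measurable_const)
  have hj : IsMultiplier (J.indicator 1) := isMultiplier_one.indicator hJ
  set p := boundedMul Ω (J.indicator 1) with hpdef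
  have hpα : p * α = α * p := by
    rw [hαdef, hpdef, boundedMul_mul hj hα, boundedMul_mul hα hj, mul_comm]
  have hpχ : p * χ = χ := by
    rw [hχdef, hpdef, boundedMul_mul hj hχ]
    refine boundedMul_congr hΩ (hj.mul hχ) hχ fun k _ => ?_
    rw [Pi.mul_apply]
    by_cases hk : k ∈ J
    · rw [indicator_of_mem hk, Pi.one_apply, one_mul]
    · rw [indicator_of_notMem hk, zero_mul, eq_comm, windowHat]
      by_contra hk'
      have hkW : k ∈ W := by
        by_contra hkW
        exact hk' (indicator_of_notMem hkW _)
      rw [indicator_of_mem hkW] at hk'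
      exact hk ⟨hkW, abs_sub_le_of_hat_ne_zero hh hk'⟩
  -- `p X` solves the same equation, so uniqueness gives `p X = X`. The range of `X` therefore lies
  -- where the truncation of `e - c` is inactive.
  have hpX : p * X = X := by
    refine eq_of_eq_mul_mul_add hn ?_ hX
    conv_lhs => rw [hX]
    rw [mul_add, mul_neg, ← mul_assoc, ← mul_assoc, hpα, ← mul_assoc, ← mul_assoc, hpχ, mul_assoc α]
  have hζQ : ζ * Q = ζ := by
    rw [hζdef, hQdef, boundedMul_mul hζ hq]
    refine boundedMul_congr hΩ (hζ.mul hq) hζ fun k _ => ?_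
    rw [Pi.mul_apply, outerInverse]
    by_cases hk : k ∈ Wᶜ
    · rw [indicator_of_mem hk, indicator_of_mem hk, Pi.one_apply, mul_one]
    · rw [indicator_of_notMem hk, zero_mul]
  have hXQ : X * Q = X := by
    conv_lhs => rw [hX]
    rw [add_mul, neg_mul, mul_assoc (α * X), hζQ, mul_assoc (χ * Y), hζQ]
    exact hX.symm
  have hleft : p (mulOperator Ω e f - (c : ℂ) • (f : Amplitude Ω)) = p (α f) := by
    rw [← mul_apply_eq_comp, hpdef, hαdef, boundedMul_mul hj hα]
    refine boundedMul_mulOperator_sub hΩ hj (hj.mul hα) (fun k _ => ?_) f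
    rw [Pi.mul_apply]
    by_cases hk : k ∈ J
    · rw [innerEnergy, indicator_of_mem hk.1, clampAt_of_abs_le hk.2]
    · rw [indicator_of_notMem hk, zero_mul, zero_mul]
  have hright : ζ (mulOperator Ω e g - (c : ℂ) • (g : Amplitude Ω)) = Q g := by
    rw [hζdef, hQdef]
    refine boundedMul_mulOperator_sub hΩ hζ hq (fun k hk => ?_) g
    rw [outerInverse]
    by_cases hkW : k ∈ Wᶜ
    · rw [indicator_of_mem hkW, indicator_of_mem hkW, Pi.one_apply]
      exact cutInv_mul_self (by positivity) (hout k ⟨hk, hkW⟩)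
    · rw [indicator_of_notMem hkW, indicator_of_notMem hkW, zero_mul]
  have hl : inner ℂ (mulOperator Ω e f - (c : ℂ) • (f : Amplitude Ω)) (X g) =
      inner ℂ (f : Amplitude Ω) (α (X g)) := by
    have hXg : X g = p (X g) := by rw [← mul_apply_eq_comp, hpX]
    rw [hXg, ← inner_boundedMul hj, ← hpdef, hleft, inner_boundedMul hj, inner_boundedMul hα,
      ← hpdef, ← hXg]
  have hr : X (mulOperator Ω e g - (c : ℂ) • (g : Amplitude Ω)) =
      α (X g) - (χ * Y * Q) g := by
    conv_lhs => rw [hX]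
    rw [_root_.add_apply, _root_.neg_apply, mul_apply_eq_comp, mul_apply_eq_comp (χ * Y), hright,
      ← sub_eq_add_neg,
      mul_apply_eq_comp, ← mul_apply_eq_comp X, hXQ, ← mul_apply_eq_comp (χ * Y)]
  -- The real shift `c` contributes the same term to both sides and cancels from the commutator.
  have hl' : inner ℂ (mulOperator Ω e f) (X g) =
      inner ℂ (f : Amplitude Ω) (α (X g)) + (c : ℂ) * inner ℂ (f : Amplitude Ω) (X g) := by
    rw [inner_sub_left, inner_smul_left, Complex.conj_ofReal] at hl
    linear_combination hl
  have hr' : inner ℂ (f : Amplitude Ω) (X (mulOperator Ω e g)) =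
      inner ℂ (f : Amplitude Ω) (α (X g)) - inner ℂ (f : Amplitude Ω) ((χ * Y * Q) g) +
        (c : ℂ) * inner ℂ (f : Amplitude Ω) (X g) := by
    have h1 := congrArg (inner ℂ (f : Amplitude Ω)) hr
    rw [map_sub, map_smul, inner_sub_right, inner_sub_right, inner_smul_right] at h1
    linear_combination h1
  rw [hl', hr']
  ring

end Sylvester

/-! ### Gluing the pieces, Lipschitz in the parameter -/

section Family

variable {Ω W : Set ℝ} {e : ℝ → ℝ → ℝ}

theorem lipFamily_boundedMul (hΩ : MeasurableSet Ω) {m : ℝ → ℝ → ℝ}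
    (hm : ∀ s ∈ Icc (0 : ℝ) 1, IsMultiplier (m s)) {K : ℝ} (hK0 : 0 ≤ K)
    (hK : ∀ k ∈ Ω, ∀ s ∈ Icc (0 : ℝ) 1, ∀ t ∈ Icc (0 : ℝ) 1, |m s k - m t k| ≤ K * |s - t|) :
    LipFamily fun s => boundedMul Ω (m s) :=
  LipFamily.of_lipschitz (B := K) fun s hs t ht =>
    norm_boundedMul_sub_le hΩ (hm s hs) (hm t ht) (by positivity) fun k hk => hK k hk s hs t ht

/-- Solution of the weak Sylvester equation `e X - X e = 1_W Y (1 - 1_W)` that is Lipschitz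
continuous in the parameter, in the presence of a gap between the energies inside and outside `W`. -/
theorem exists_lipFamily_weak_commutator (hΩ : MeasurableSet Ω) (hW : MeasurableSet W)
    (he : ∀ s ∈ Icc (0 : ℝ) 1, Measurable fun k => e k s) {K : ℝ} (hK0 : 0 ≤ K)
    (hK : ∀ k ∈ Ω, ∀ s ∈ Icc (0 : ℝ) 1, ∀ t ∈ Icc (0 : ℝ) 1,
      |e k s - e k t| ≤ K * (1 + |e k t|) * |s - t|)
    {M : ℝ} (hM : ∀ s ∈ Icc (0 : ℝ) 1, ∀ k ∈ Ω ∩ W, |e k s| ≤ M) {δ : ℝ} (hδ : 0 < δ)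
    (hgap : ∀ s ∈ Icc (0 : ℝ) 1, ∀ k' ∈ Ω ∩ W, ∀ k'' ∈ Ω \ W, δ ≤ |e k' s - e k'' s|)
    {Y : ℝ → Amplitude Ω →L[ℂ] Amplitude Ω} (hY : LipFamily Y) :
    ∃ X : ℝ → Amplitude Ω →L[ℂ] Amplitude Ω, LipFamily X ∧ ∀ s ∈ Icc (0 : ℝ) 1,
      ∀ f g : (mulOperator Ω fun k => e k s).domain,
        inner ℂ (mulOperator Ω (fun k => e k s) f) (X s g) -
            inner ℂ (f : Amplitude Ω) (X s (mulOperator Ω (fun k => e k s) g)) =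
          inner ℂ (f : Amplitude Ω)
            ((boundedMul Ω (W.indicator 1) * Y s * boundedMul Ω (Wᶜ.indicator 1)) g) := by
  -- With `3h = δ`, levels within `h` of a center leave a margin of `2h` to the outside.
  set h := δ / 3 with hhdef
  have hh : 0 < h := by positivity
  obtain ⟨u, hu⟩ := exists_sum_hat_eq_one hh M
  set c : ℕ → ℝ := fun n => -M + n * h
  let α : ℕ → ℝ → Amplitude Ω →L[ℂ] Amplitude Ω := fun n s =>
    boundedMul Ω (innerEnergy W h (c n) fun k => e k s)
  let ζ : ℕ → ℝ → Amplitude Ω →L[ℂ] Amplitude Ω := fun n s =>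
    boundedMul Ω (outerInverse W h (c n) fun k => e k s)
  let χ : ℕ → ℝ → Amplitude Ω →L[ℂ] Amplitude Ω := fun n s =>
    boundedMul Ω (windowHat W h (c n) fun k => e k s)
  have hinner : ∀ k ∈ Ω ∩ W, ∀ s ∈ Icc (0 : ℝ) 1, ∀ t ∈ Icc (0 : ℝ) 1,
      |e k s - e k t| ≤ K * (1 + |M|) * |s - t| := fun k hk s hs t ht => by
    refine (hK k hk.1 s hs t ht).trans ?_
    have := (hM t ht k hk).trans (le_abs_self M)
    gcongr
  have hα : ∀ n, LipFamily (α n) := fun n => by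
    refine lipFamily_boundedMul hΩ (fun s hs => isMultiplier_innerEnergy hW (he s hs) hh)
      (K := K * (1 + |M|)) (by positivity) fun k hk s hs t ht => ?_
    simp only [innerEnergy]
    by_cases hkW : k ∈ W
    · rw [indicator_of_mem hkW, indicator_of_mem hkW]
      refine (abs_clampAt_sub_le _ _ _).trans ?_
      rw [sub_sub_sub_cancel_right]
      exact hinner k ⟨hk, hkW⟩ s hs t ht
    · rw [indicator_of_notMem hkW, indicator_of_notMem hkW, sub_self, abs_zero]
      positivity
  have hχ : ∀ n, LipFamily (χ n) := fun n => by
    refine lipFamily_boundedMul hΩ (fun s hs => isMultiplier_windowHat hW (he s hs))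
      (K := 2 / h * (K * (1 + |M|))) (by positivity) fun k hk s hs t ht => ?_
    simp only [windowHat]
    by_cases hkW : k ∈ W
    · rw [indicator_of_mem hkW, indicator_of_mem hkW, mul_assoc (2 / h)]
      refine (abs_hat_sub_le hh _ _ _).trans ?_
      have := hinner k ⟨hk, hkW⟩ s hs t ht
      gcongr
    · rw [indicator_of_notMem hkW, indicator_of_notMem hkW, sub_self, abs_zero]
      positivity
  -- Outside the window the energies may be unbounded; the bound `1 + |e| ≤ const · m` cancels the
  -- decay of `cutInv` against their growth.
  have hζ : ∀ n, LipFamily (ζ n) := fun n => by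
    refine lipFamily_boundedMul hΩ (fun s hs => isMultiplier_outerInverse hW (he s hs) hh)
      (K := K * ((1 + |c n|) / (2 * h) + 1) / (2 * h)) (by positivity) fun k hk s hs t ht => ?_
    simp only [outerInverse]
    by_cases hkW : k ∈ Wᶜ
    · rw [indicator_of_mem hkW, indicator_of_mem hkW]
      refine (abs_cutInv_sub_le (by positivity) _ _).trans ?_
      rw [sub_sub_sub_cancel_right]
      set m := max (2 * h) |e k t - c n| with hm
      have hm0 : 0 < m := lt_max_of_lt_left (by positivity)
      have h1 : 1 + |e k t| ≤ ((1 + |c n|) / (2 * h) + 1) * m := by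
        have h2 : |e k t| ≤ |e k t - c n| + |c n| := by
          simpa using abs_add_le (e k t - c n) (c n)
        have h3 : |e k t - c n| ≤ m := le_max_right _ _
        have h4 : 1 + |c n| ≤ (1 + |c n|) / (2 * h) * m := by
          rw [div_mul_eq_mul_div, le_div_iff₀ (by positivity)]
          exact mul_le_mul_of_nonneg_left (le_max_left _ _) (by positivity)
        linarith
      rw [div_le_iff₀ (by positivity)]
      calc _ ≤ _ := hK k hk s hs t ht
        _ ≤ K * (((1 + |c n|) / (2 * h) + 1) * m) * |s - t| := by gcongr
        _ = _ := by field_simp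
    · rw [indicator_of_notMem hkW, indicator_of_notMem hkW, sub_self, abs_zero]
      positivity
  have hnorm : ∀ n, ∀ s ∈ Icc (0 : ℝ) 1, ‖α n s‖ * ‖ζ n s‖ ≤ 1 / 2 := fun n s hs =>
    norm_innerEnergy_mul_norm_outerInverse_le hΩ hW (he s hs) hh
  have hex : ∀ n, ∀ s, ∃ X, s ∈ Icc (0 : ℝ) 1 →
      X = α n s * X * ζ n s + -(χ n s * Y s * ζ n s) := fun n s => by
    by_cases hs : s ∈ Icc (0 : ℝ) 1
    · obtain ⟨X, hX⟩ := exists_eq_mul_mul_add (hnorm n s hs) (-(χ n s * Y s * ζ n s))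
      exact ⟨X, fun _ => hX⟩
    · exact ⟨0, fun h => absurd h hs⟩
  choose X hX using hex
  refine ⟨fun s => ∑ n ∈ Finset.range u, X n s, LipFamily.sum _ fun n _ =>
    LipFamily.of_eq_mul_mul_add (hα n) (hζ n) (((hχ n).mul hY).mul (hζ n)).neg (hnorm n)
      (hX n), fun s hs f g => ?_⟩
  have hgap' : ∀ k' ∈ Ω ∩ W, ∀ k'' ∈ Ω \ W, 3 * h ≤ |e k' s - e k'' s| := fun k' hk' k'' hk'' => by
    rw [hhdef, mul_div_cancel₀ _ three_ne_zero]
    exact hgap s hs k' hk' k'' hk''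
  have hw : IsMultiplier (W.indicator 1) := isMultiplier_one.indicator hW
  have hsm : IsMultiplier fun k => ∑ n ∈ Finset.range u, windowHat W h (c n) (fun k => e k s) k := by
    refine ⟨Finset.measurable_fun_sum _ fun n _ => (isMultiplier_windowHat hW (he s hs)).1,
      ∑ n ∈ Finset.range u, 1, fun k => ?_⟩
    refine (Finset.abs_sum_le_sum_abs _ _).trans (Finset.sum_le_sum fun n _ => ?_)
    rw [windowHat, ← Real.norm_eq_abs]
    exact (norm_indicator_le_norm_self _ k).trans (abs_hat_le _ _ _)
  -- The hats sum to one on `[-M, M]`, which contains all window energies, so the local sources add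
  -- up to the full one.
  have hsum : ∑ n ∈ Finset.range u, χ n s = boundedMul Ω (W.indicator 1) := by
    refine (boundedMul_sum _ (fun n => isMultiplier_windowHat hW (he s hs)) hsm).trans ?_
    refine boundedMul_congr hΩ hsm hw fun k hk => ?_
    simp only [windowHat]
    by_cases hkW : k ∈ W
    · simp only [indicator_of_mem hkW]
      exact hu _ (hM s hs k ⟨hk, hkW⟩)
    · simp only [indicator_of_notMem hkW, Finset.sum_const_zero]
  rw [← hsum, Finset.sum_mul, Finset.sum_mul]
  simp only [_root_.sum_apply, inner_sum]
  rw [← Finset.sum_sub_distrib]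
  exact Finset.sum_congr rfl fun n _ =>
    weak_commutator_windowHat hΩ hW (he s hs) hh hgap' (hX n s hs) f g

end Family

/-! ### Schrödinger dynamics and integration by parts -/

variable {𝓗 : Type*} [NormedAddCommGroup 𝓗] [InnerProductSpace ℂ 𝓗]

/-- `u` solves `iħ u' = T H u` on `[0,1]`. -/
def IsSolution (H : ℝ → 𝓗 →ₗ.[ℂ] 𝓗) (ħ T : ℝ) (u : ℝ → 𝓗) : Prop :=
  ∀ s ∈ Icc (0 : ℝ) 1, ∃ h : u s ∈ (H s).domain, ∃ v : 𝓗,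
    HasDerivWithinAt u v (Icc 0 1) s ∧
      (Complex.I * (ħ : ℂ)) • v = (T : ℂ) • H s ⟨u s, h⟩

theorem hasDerivWithinAt_inner_clm_apply {u w : ℝ → 𝓗} {A : ℝ → 𝓗 →L[ℂ] 𝓗} {u' w' : 𝓗}
    {A' : 𝓗 →L[ℂ] 𝓗} {I : Set ℝ} {s : ℝ} (hu : HasDerivWithinAt u u' I s)
    (hw : HasDerivWithinAt w w' I s) (hA : HasDerivWithinAt A A' I s) :
    HasDerivWithinAt (fun r => inner ℂ (u r) (A r (w r)))
      (inner ℂ (u s) (A' (w s) + A s w') + inner ℂ u' (A s (w s))) I s := by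
  have h1 := (ContinuousLinearMap.restrictScalarsL ℂ 𝓗 𝓗 ℝ ℝ).hasFDerivAt.comp_hasDerivWithinAt
    s hA
  exact hu.inner ℂ (h1.clm_apply hw)

/-- Integration by parts in the adiabatic theorem: if `X` solves `[H, X] = P'` weakly and is
Lipschitz continuous, then the matrix elements of `P` between solutions of the Schrödinger equation
vary by `O(1/T)`. -/
theorem norm_inner_sub_inner_le {H : ℝ → 𝓗 →ₗ.[ℂ] 𝓗} {P P' X : ℝ → 𝓗 →L[ℂ] 𝓗} {K : ℝ}
    (hP : ∀ s ∈ Icc (0 : ℝ) 1, HasDerivWithinAt P (P' s) (Icc 0 1) s) (hK0 : 0 ≤ K)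
    (hX : ∀ s ∈ Icc (0 : ℝ) 1, ‖X s‖ ≤ K)
    (hX' : ∀ s ∈ Icc (0 : ℝ) 1, ∀ t ∈ Icc (0 : ℝ) 1, ‖X s - X t‖ ≤ K * |s - t|)
    (hcP : ∀ s ∈ Icc (0 : ℝ) 1, ∀ f g : (H s).domain,
      inner ℂ (H s f) (P s g) = inner ℂ (f : 𝓗) (P s (H s g)))
    (hcX : ∀ s ∈ Icc (0 : ℝ) 1, ∀ f g : (H s).domain,
      inner ℂ (H s f) (X s g) - inner ℂ (f : 𝓗) (X s (H s g)) = inner ℂ (f : 𝓗) (P' s g))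
    {ħ T : ℝ} (hħ : 0 < ħ) (hT : 0 < T) {u w : ℝ → 𝓗} (hu : IsSolution H ħ T u)
    (hw : IsSolution H ħ T w) {a b : ℝ} (ha : ∀ s ∈ Icc (0 : ℝ) 1, ‖u s‖ ≤ a)
    (hb : ∀ s ∈ Icc (0 : ℝ) 1, ‖w s‖ ≤ b) :
    ∀ s ∈ Icc (0 : ℝ) 1,
      ‖inner ℂ (u s) (P s (w s)) - inner ℂ (u 0) (P 0 (w 0))‖ ≤ 3 * ħ * K / T * (a * b) := by
  have h01 : (0 : ℝ) ∈ Icc (0 : ℝ) 1 := by simp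
  have ha0 : 0 ≤ a := (norm_nonneg _).trans (ha 0 h01)
  have hb0 : 0 ≤ b := (norm_nonneg _).trans (hb 0 h01)
  set γ : ℂ := Complex.I * ħ / T with hγ
  have hT' : (T : ℂ) ≠ 0 := Complex.ofReal_ne_zero.2 hT.ne'
  have hγn : ‖γ‖ = ħ / T := by
    rw [hγ, norm_div, norm_mul, Complex.norm_I, one_mul, Complex.norm_real, Complex.norm_real,
      Real.norm_of_nonneg hħ.le, Real.norm_of_nonneg hT.le]
  -- `γ` is imaginary: this sign makes the commutator with `H` a time derivative of matrix elements.
  have hγc : (starRingEnd ℂ) γ = -γ := by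
    rw [hγ, map_div₀, map_mul, Complex.conj_I, Complex.conj_ofReal, Complex.conj_ofReal]
    ring
  have hsol : ∀ {y : ℝ → 𝓗}, IsSolution H ħ T y → ∀ s ∈ Icc (0 : ℝ) 1,
      ∃ h : y s ∈ (H s).domain, ∃ v : 𝓗,
        HasDerivWithinAt y v (Icc 0 1) s ∧ H s ⟨y s, h⟩ = γ • v := by
    intro y hy s hs
    obtain ⟨h, v, hv, he⟩ := hy s hs
    refine ⟨h, v, hv, ?_⟩
    rw [hγ, div_eq_inv_mul, mul_smul, he, smul_smul, inv_mul_cancel₀ hT', one_smul]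
  have hbound : ∀ (A : 𝓗 →L[ℂ] 𝓗) (c : ℝ), ‖A‖ ≤ c → ∀ r ∈ Icc (0 : ℝ) 1,
      ‖γ * inner ℂ (u r) (A (w r))‖ ≤ ħ / T * (c * (a * b)) := by
    intro A c hA r hr
    have hc : 0 ≤ c := (norm_nonneg _).trans hA
    rw [norm_mul, hγn]
    refine mul_le_mul_of_nonneg_left ?_ (by positivity)
    calc _ ≤ ‖u r‖ * ‖A (w r)‖ := norm_inner_le_norm _ _
      _ ≤ a * (c * b) := mul_le_mul (ha r hr) (A.le_of_opNorm_le_of_le hA (hb r hr))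
          (norm_nonneg _) ha0
      _ = _ := by ring
  let G : ℝ → ℂ := fun r => inner ℂ (u r) (P r (w r)) + γ * inner ℂ (u r) (X r (w r))
  -- `Φ s` is `G` with `X` frozen at time `s`. It is differentiable although `X` is only Lipschitz,
  -- and its derivative at `s` vanishes.
  let Φ : ℝ → ℝ → ℂ := fun s r => inner ℂ (u r) (P r (w r)) + γ * inner ℂ (u r) (X s (w r))
  have hΦ : ∀ s ∈ Icc (0 : ℝ) 1, HasDerivWithinAt (Φ s) 0 (Icc 0 1) s := by
    intro s hs
    obtain ⟨hus, v, hv, hHv⟩ := hsol hu s hs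
    obtain ⟨hws, v', hv', hHv'⟩ := hsol hw s hs
    have h1 := hasDerivWithinAt_inner_clm_apply hv hv' (hP s hs)
    have h2 := (hasDerivWithinAt_inner_clm_apply hv hv'
      (hasDerivWithinAt_const s (Icc 0 1) (X s))).const_mul γ
    have e1 := hcP s hs ⟨u s, hus⟩ ⟨w s, hws⟩
    have e2 := hcX s hs ⟨u s, hus⟩ ⟨w s, hws⟩
    simp only [hHv, hHv', map_smul, inner_smul_left, inner_smul_right, hγc] at e1 e2
    have hγ0 : γ ≠ 0 := norm_pos_iff.1 (hγn ▸ div_pos hħ hT)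
    have e3 : inner ℂ v (P s (w s)) + inner ℂ (u s) (P s v') = 0 :=
      mul_left_cancel₀ hγ0 (by linear_combination -e1)
    refine (h1.add h2).congr_deriv ?_
    rw [inner_add_right, _root_.zero_apply, zero_add]
    linear_combination e3 - e2
  have hGΦ : ∀ s r, G r - G s = (Φ s r - Φ s s) + γ * inner ℂ (u r) ((X r - X s) (w r)) := by
    intro s r
    simp only [G, Φ, _root_.sub_apply, inner_sub_right]
    ring
  have hGc : ContinuousOn G (Icc 0 1) := by
    intro s hs
    obtain ⟨-, v, hv, -⟩ := hsol hu s hs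
    obtain ⟨-, v', hv', -⟩ := hsol hw s hs
    have hXc : ContinuousOn X (Icc 0 1) :=
      LipFamily.continuousOn (LipFamily.of_lipschitz hX')
    exact (hv.continuousWithinAt.inner
        ((hP s hs).continuousWithinAt.clm_apply hv'.continuousWithinAt)).add
      (continuousWithinAt_const.mul (hv.continuousWithinAt.inner
        ((hXc s hs).clm_apply hv'.continuousWithinAt)))
  have hmain := norm_sub_le_of_eventually_norm_sub_le (K := ħ / T * (K * (a * b))) hGc ?_
  · intro s hs
    -- The factor `3` counts the increment of `G` and the two boundary terms with `X s` and `X 0`.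
    have e : inner ℂ (u s) (P s (w s)) - inner ℂ (u 0) (P 0 (w 0)) =
        (G s - G 0) - γ * inner ℂ (u s) (X s (w s)) + γ * inner ℂ (u 0) (X 0 (w 0)) := by
      simp only [G]; ring
    have h1 := hmain s hs
    have h2 := hbound (X s) K (hX s hs) s hs
    have h3 := hbound (X 0) K (hX 0 h01) 0 h01
    have h4 : ħ / T * (K * (a * b)) * s ≤ ħ / T * (K * (a * b)) :=
      mul_le_of_le_one_right (by positivity) hs.2
    rw [e]
    calc _ ≤ _ := norm_add_le _ _
      _ ≤ _ := add_le_add_left (norm_sub_le _ _) _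
      _ ≤ ħ / T * (K * (a * b)) + ħ / T * (K * (a * b)) + ħ / T * (K * (a * b)) :=
        add_le_add (add_le_add (h1.trans h4) h2) h3
      _ = _ := by ring
  · intro s hs ε hε
    have hsI : s ∈ Icc (0 : ℝ) 1 := Ico_subset_Icc_self hs
    have h1 := ((hΦ s hsI).hasFDerivWithinAt.isLittleO).def hε
    have hle : 𝓝[>] s ≤ 𝓝[Icc 0 1] s :=
      nhdsWithin_le_of_mem (mem_of_superset (Ioc_mem_nhdsGT hs.2)
        fun r hr => ⟨hs.1.trans hr.1.le, hr.2⟩)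
    filter_upwards [hle h1, self_mem_nhdsWithin, hle self_mem_nhdsWithin] with r hr hsr hrI
    have hrs : 0 < r - s := sub_pos.2 hsr
    rw [hGΦ]
    have h2 : ‖Φ s r - Φ s s‖ ≤ ε * (r - s) := by
      simpa [Real.norm_eq_abs, abs_of_pos hrs] using hr
    have h3 := hbound (X r - X s) _ (hX' r hrI s hsI) r hrI
    rw [abs_of_pos hrs] at h3
    calc _ ≤ _ := norm_add_le _ _
      _ ≤ _ := add_le_add h2 h3
      _ = _ := by ring

/-- An evolution that almost preserves the matrix elements of a family of operators almost
intertwines them. -/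
theorem norm_comp_sub_comp_le {U P₀ P : 𝓗 →L[ℂ] 𝓗} (hU : ∀ f, ‖U f‖ = ‖f‖)
    (hsurj : Function.Surjective U) {D : Set 𝓗} (hD : Dense D) {C : ℝ} (hC0 : 0 ≤ C)
    (hC : ∀ f ∈ D, ∀ g ∈ D, ‖inner ℂ (U f) (P (U g)) - inner ℂ f (P₀ g)‖ ≤ C * (‖f‖ * ‖g‖)) :
    ‖U ∘L P₀ - P ∘L U‖ ≤ C := by
  have hC' : ∀ f g, ‖inner ℂ (U f) (P (U g)) - inner ℂ f (P₀ g)‖ ≤ C * (‖f‖ * ‖g‖) := by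
    intro f g
    refine hD.induction (P := fun f => ‖inner ℂ (U f) (P (U g)) - inner ℂ f (P₀ g)‖ ≤
      C * (‖f‖ * ‖g‖)) (fun f hf => ?_) (isClosed_le (by fun_prop) (by fun_prop)) f
    exact hD.induction (P := fun g => ‖inner ℂ (U f) (P (U g)) - inner ℂ f (P₀ g)‖ ≤
      C * (‖f‖ * ‖g‖)) (fun g hg => hC f hf g hg) (isClosed_le (by fun_prop) (by fun_prop)) g
  have hinner : ∀ f g, inner ℂ (U f) (U g) = inner ℂ f g :=
    (LinearIsometry.mk (U : 𝓗 →ₗ[ℂ] 𝓗) hU).inner_map_map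
  refine ContinuousLinearMap.opNorm_le_bound _ hC0 fun g => ?_
  -- With this `f` the difference of matrix elements is minus the squared norm of the vector to be
  -- estimated.
  obtain ⟨f, hf⟩ := hsurj ((U ∘L P₀ - P ∘L U) g)
  have h1 := hC' f g
  have h2 : inner ℂ (U f) (P (U g)) - inner ℂ f (P₀ g) =
      -inner ℂ ((U ∘L P₀ - P ∘L U) g) ((U ∘L P₀ - P ∘L U) g) := by
    rw [← hinner f (P₀ g), ← inner_sub_right, ← inner_neg_right, ← hf]
    congr 1
    rw [hf]
    simp
  rw [h2, norm_neg, inner_self_eq_norm_sq_to_K, norm_pow, RCLike.norm_ofReal, abs_norm, ← hU f, hf,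
    sq] at h1
  rcases (norm_nonneg ((U ∘L P₀ - P ∘L U) g)).eq_or_lt with h0 | h0
  · rw [← h0]; positivity
  · refine le_of_mul_le_mul_left ?_ h0
    linarith

/-! ### Transfer from amplitudes to the Hilbert space -/

namespace ContinuousSpectrum

variable (S : ContinuousSpectrum 𝓗)

/-- The operator on `𝓗` that acts on amplitudes at time `s` as `A`. -/
def fromAmplitude (s : ℝ) (A : Amplitude S.labels →L[ℂ] Amplitude S.labels) : 𝓗 →L[ℂ] 𝓗 :=
  ((S.expansion s).symm : Amplitude S.labels →L[ℂ] 𝓗) ∘L A ∘L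
    ((S.expansion s) : 𝓗 →L[ℂ] Amplitude S.labels)

variable {S}

theorem fromAmplitude_apply (s : ℝ) (A : Amplitude S.labels →L[ℂ] Amplitude S.labels) (f : 𝓗) :
    S.fromAmplitude s A f = (S.expansion s).symm (A (S.expansion s f)) := rfl

theorem fromAmplitude_mul (s : ℝ) (A B : Amplitude S.labels →L[ℂ] Amplitude S.labels) :
    S.fromAmplitude s (A * B) = S.fromAmplitude s A * S.fromAmplitude s B := by
  ext1 f
  simp only [mul_apply_eq_comp, fromAmplitude_apply, LinearIsometryEquiv.apply_symm_apply]

theorem inner_fromAmplitude (s : ℝ) (A : Amplitude S.labels →L[ℂ] Amplitude S.labels) (f g : 𝓗) :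
    inner ℂ f (S.fromAmplitude s A g) = inner ℂ (S.expansion s f) (A (S.expansion s g)) := by
  rw [fromAmplitude_apply, ← (S.expansion s).inner_map_map, LinearIsometryEquiv.apply_symm_apply]

/-- Weak commutators with the Hamiltonian, computed on amplitudes. -/
theorem inner_hamiltonian_fromAmplitude {s : ℝ}
    {A B : Amplitude S.labels →L[ℂ] Amplitude S.labels}
    (h : ∀ f g : (mulOperator S.labels fun k => S.energy k s).domain,
      inner ℂ (mulOperator S.labels (fun k => S.energy k s) f) (A g) -
          inner ℂ (f : Amplitude S.labels) (A (mulOperator S.labels (fun k => S.energy k s) g)) =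
        inner ℂ (f : Amplitude S.labels) (B g))
    (f g : (S.hamiltonian s).domain) :
    inner ℂ (S.hamiltonian s f) (S.fromAmplitude s A g) -
        inner ℂ (f : 𝓗) (S.fromAmplitude s A (S.hamiltonian s g)) =
      inner ℂ (f : 𝓗) (S.fromAmplitude s B g) := by
  have e : ∀ f : (S.hamiltonian s).domain, S.expansion s (S.hamiltonian s f) =
      mulOperator S.labels (fun k => S.energy k s) ⟨S.expansion s f, f.2⟩ := fun f =>
    (S.expansion s).apply_symm_apply _
  rw [inner_fromAmplitude, inner_fromAmplitude, inner_fromAmplitude, e, e]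
  exact h ⟨S.expansion s f, f.2⟩ ⟨S.expansion s g, g.2⟩

theorem dense_hamiltonian_domain {s : ℝ} (hs : s ∈ Icc (0 : ℝ) 1) :
    Dense ((S.hamiltonian s).domain : Set 𝓗) :=
  (dense_mulOperator_domain (S.measurable_energy s hs)).preimage
    (S.expansion s).toHomeomorph.isOpenMap

theorem lipFamily_symm (hφ : S.DifferentiableEigenfunctions) :
    LipFamily fun s => ((S.expansion s).symm : Amplitude S.labels →L[ℂ] 𝓗) :=
  LipFamily.of_strong fun C => LipFamily.of_contDiffOn (hφ C)

/-- The expansions are isometries, so the Lipschitz bound passes to inverses through `A - B = A (B⁻¹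
- A⁻¹) B`. -/
theorem lipFamily_expansion (hφ : S.DifferentiableEigenfunctions) :
    LipFamily fun s => ((S.expansion s) : 𝓗 →L[ℂ] Amplitude S.labels) := by
  obtain ⟨K, hK0, -, hK⟩ := lipFamily_symm hφ
  refine LipFamily.of_lipschitz (B := K) fun s hs t ht =>
    ContinuousLinearMap.opNorm_le_bound _ (by positivity) fun f => ?_
  have e : S.expansion s f - S.expansion t f = S.expansion s
      ((S.expansion t).symm (S.expansion t f) - (S.expansion s).symm (S.expansion t f)) := by
    rw [map_sub, LinearIsometryEquiv.symm_apply_apply, LinearIsometryEquiv.apply_symm_apply]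
  have h1 := ContinuousLinearMap.le_of_opNorm_le _ (hK t ht s hs) (S.expansion t f)
  rw [LinearIsometryEquiv.norm_map, abs_sub_comm] at h1
  refine (congrArg norm e).trans_le ?_
  rw [LinearIsometryEquiv.norm_map]
  exact h1

theorem lipFamily_fromAmplitude (hφ : S.DifferentiableEigenfunctions)
    {A : ℝ → Amplitude S.labels →L[ℂ] Amplitude S.labels} (hA : LipFamily A) :
    LipFamily fun s => S.fromAmplitude s (A s) :=
  (lipFamily_symm hφ).clm_comp (hA.clm_comp (lipFamily_expansion hφ))

/-- The energies do not depend on `T`, so a single large `T` already yields a fixed gap. -/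
theorem VirtualGap.exists_pos {k δk : ℝ} (h : S.VirtualGap k δk) :
    ∃ δ > 0, ∀ s ∈ Icc (0 : ℝ) 1, ∀ k' ∈ S.labels ∩ Icc k (k + δk),
      ∀ k'' ∈ S.labels \ Icc k (k + δk), δ ≤ |S.energy k' s - S.energy k'' s| := by
  obtain ⟨T, hT, hT0⟩ := ((h 1).and (eventually_gt_atTop 0)).exists
  exact ⟨1 * (1 / T), by positivity, hT⟩

theorem diffProjector_eq (k δk s : ℝ) :
    S.diffProjector k δk s =
      S.fromAmplitude s (boundedMul S.labels ((Icc k (k + δk)).indicator 1)) := by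
  rw [← cutoff_eq_boundedMul measurableSet_Icc]
  rfl

theorem diffProjector_mul_self (k δk s : ℝ) :
    S.diffProjector k δk s * S.diffProjector k δk s = S.diffProjector k δk s := by
  have hw := isMultiplier_one.indicator (measurableSet_Icc (a := k) (b := k + δk))
  rw [diffProjector_eq, ← fromAmplitude_mul, boundedMul_mul hw hw]
  congr 2
  ext x
  by_cases hx : x ∈ Icc k (k + δk) <;> simp [indicator, hx]

theorem one_sub_diffProjector (k δk s : ℝ) :
    1 - S.diffProjector k δk s =
      S.fromAmplitude s (boundedMul S.labels ((Icc k (k + δk))ᶜ.indicator 1)) := by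
  have hw := isMultiplier_one.indicator (measurableSet_Icc (a := k) (b := k + δk))
  have hq := isMultiplier_one.indicator (measurableSet_Icc (a := k) (b := k + δk)).compl
  have e : ∀ f, f - boundedMul S.labels ((Icc k (k + δk)).indicator 1) f =
      boundedMul S.labels ((Icc k (k + δk))ᶜ.indicator 1) f := fun f => by
    refine Lp.ext ?_
    filter_upwards [coeFn_boundedMul hw f, coeFn_boundedMul hq f, Lp.coeFn_sub f
      (boundedMul S.labels ((Icc k (k + δk)).indicator 1) f)] with x h1 h2 h3
    rw [h3, Pi.sub_apply, h1, h2]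
    by_cases hx : x ∈ Icc k (k + δk)
    · rw [indicator_of_mem hx, indicator_of_notMem (not_not.2 hx)]; simp
    · rw [indicator_of_notMem hx, indicator_of_mem (mem_compl hx)]; simp
  ext1 f
  rw [_root_.sub_apply, one_apply_eq_self, diffProjector_eq, fromAmplitude_apply,
    fromAmplitude_apply, ← e, map_sub, LinearIsometryEquiv.symm_apply_apply]

variable [CompleteSpace 𝓗]

theorem star_diffProjector (k δk s : ℝ) :
    star (S.diffProjector k δk s) = S.diffProjector k δk s := by
  have hw := isMultiplier_one.indicator (measurableSet_Icc (a := k) (b := k + δk))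
  refine (ContinuousLinearMap.isSelfAdjoint_iff_isSymmetric.2 fun f g => ?_)
  rw [ContinuousLinearMap.coe_coe, diffProjector_eq, inner_fromAmplitude, ← inner_boundedMul hw,
    ← (S.expansion s).inner_map_map, fromAmplitude_apply, LinearIsometryEquiv.apply_symm_apply]

/-- A Lipschitz continuous solution of `[H, X] = P'` in the weak sense. -/
theorem exists_weak_commutator_eq_deriv (hE : S.PiecewiseDifferentiableEnergy)
    (hφ : S.DifferentiableEigenfunctions) {k δk : ℝ} (hwindow : S.BoundedWindow k δk)
    (hgap : S.VirtualGap k δk) {P' : ℝ → 𝓗 →L[ℂ] 𝓗} (hP' : LipFamily P')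
    (hP : ∀ s ∈ Icc (0 : ℝ) 1,
      HasDerivWithinAt (fun s => S.diffProjector k δk s) (P' s) (Icc 0 1) s) :
    ∃ X : ℝ → 𝓗 →L[ℂ] 𝓗, LipFamily X ∧ ∀ s ∈ Icc (0 : ℝ) 1, ∀ f g : (S.hamiltonian s).domain,
      inner ℂ (S.hamiltonian s f) (X s g) - inner ℂ (f : 𝓗) (X s (S.hamiltonian s g)) =
        inner ℂ (f : 𝓗) (P' s g) := by
  obtain ⟨L, hL⟩ := hE
  obtain ⟨K, hK0, hK⟩ := exists_abs_sub_le_of_relative_rate hL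
  obtain ⟨M, hM⟩ := hwindow
  obtain ⟨δ, hδ, hgap⟩ := hgap.exists_pos
  have hW : MeasurableSet (Icc k (k + δk)) := measurableSet_Icc
  have hY : LipFamily fun s => ((S.expansion s) : 𝓗 →L[ℂ] Amplitude S.labels) ∘L P' s ∘L
      ((S.expansion s).symm : Amplitude S.labels →L[ℂ] 𝓗) :=
    (lipFamily_expansion hφ).clm_comp (hP'.clm_comp (lipFamily_symm hφ))
  obtain ⟨Z, hZ, hcZ⟩ := exists_lipFamily_weak_commutator S.measurableSet_labels hW
    S.measurable_energy hK0 hK hM hδ hgap hY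
  have hZ' := lipFamily_fromAmplitude hφ hZ
  -- If `[H, Z] = P P'`, then taking adjoints gives `-[H, Z*] = P' P`, and the difference `Z - Z*`
  -- produces `P'`.
  refine ⟨fun s => S.fromAmplitude s (Z s) - star (S.fromAmplitude s (Z s)), hZ'.sub hZ'.star,
    fun s hs f g => ?_⟩
  have huniq : UniqueDiffWithinAt ℝ (Icc (0 : ℝ) 1) s := uniqueDiffOn_Icc zero_lt_one s hs
  set P := S.diffProjector k δk s with hPdef
  have hPP : P * P = P := diffProjector_mul_self k δk s
  have hPs : star P = P := star_diffProjector k δk s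
  have hP's : star (P' s) = P' s := by
    have h1 := (hP s hs).star
    simp only [star_diffProjector] at h1
    exact huniq.eq_deriv _ h1 (hP s hs)
  have hP'P : P' s = P' s * P + P * P' s := by
    have h1 := (hP s hs).mul (hP s hs)
    have h2 : ((fun s => S.diffProjector k δk s) * fun s => S.diffProjector k δk s) =
        fun s => S.diffProjector k δk s := by
      ext1 r
      exact diffProjector_mul_self k δk r
    rw [h2] at h1
    exact huniq.eq_deriv _ (hP s hs) h1
  -- Compressing `P' = P' P + P P'` by `P` shows that `P P' P` equals twice itself.
  have hPP'P : P * P' s * P = 0 := by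
    have h1 : P * P' s * P = P * P' s * P + P * P' s * P := by
      conv_lhs => rw [hP'P]
      rw [mul_add, add_mul, ← mul_assoc, mul_assoc (P * P' s), hPP, ← mul_assoc, hPP]
    simpa using h1
  have hB : S.fromAmplitude s (boundedMul S.labels ((Icc k (k + δk)).indicator 1) *
      (((S.expansion s) : 𝓗 →L[ℂ] Amplitude S.labels) ∘L P' s ∘L
        ((S.expansion s).symm : Amplitude S.labels →L[ℂ] 𝓗)) *
      boundedMul S.labels ((Icc k (k + δk))ᶜ.indicator 1)) = P * P' s := by
    have h1 : S.fromAmplitude s (((S.expansion s) : 𝓗 →L[ℂ] Amplitude S.labels) ∘L P' s ∘L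
        ((S.expansion s).symm : Amplitude S.labels →L[ℂ] 𝓗)) = P' s := by
      ext1 f
      rw [fromAmplitude_apply]
      simp
    rw [fromAmplitude_mul, fromAmplitude_mul, h1, ← diffProjector_eq, ← one_sub_diffProjector,
      ← hPdef, mul_sub, mul_one, hPP'P, sub_zero]
  have hc := inner_hamiltonian_fromAmplitude (hcZ s hs)
  rw [hB] at hc
  have h1 := hc f g
  have h2 := congrArg (starRingEnd ℂ) (hc g f)
  simp only [map_sub, inner_conj_symm] at h2
  have h3 : inner ℂ ((P * P' s) (f : 𝓗)) (g : 𝓗) = inner ℂ (f : 𝓗) ((P' s * P) (g : 𝓗)) := by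
    rw [← ContinuousLinearMap.adjoint_inner_right, ← ContinuousLinearMap.star_eq_adjoint, star_mul,
      hPs, hP's]
  simp only [_root_.sub_apply, inner_sub_right, ContinuousLinearMap.star_eq_adjoint,
    ContinuousLinearMap.adjoint_inner_right]
  have h4 : inner ℂ (f : 𝓗) (P' s g) =
      inner ℂ (f : 𝓗) ((P' s * P) (g : 𝓗)) + inner ℂ (f : 𝓗) ((P * P' s) (g : 𝓗)) := by
    conv_lhs => rw [hP'P]
    rw [_root_.add_apply, inner_add_right]
  rw [h4, ← h3]
  linear_combination h1 + h2

end ContinuousSpectrum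

end

end AdiabaticContinuous

/-! ### The adiabatic theorem -/

open AdiabaticContinuous in
theorem mainTheorem1 {𝓗 : Type*} [NormedAddCommGroup 𝓗] [InnerProductSpace ℂ 𝓗]
    [CompleteSpace 𝓗] (S : ContinuousSpectrum 𝓗) (ħ : ℝ) (hħ : 0 < ħ)
    (hE : S.PiecewiseDifferentiableEnergy) (hφ : S.DifferentiableEigenfunctions)
    (k δk : ℝ) (hδk : 0 < δk)
    (hwindow : S.BoundedWindow k δk) (hgap : S.VirtualGap k δk)
    (hP : ContDiffOn ℝ 2 (fun s => S.diffProjector k δk s) (Set.Icc 0 1)) :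
    ∃ C : ℝ, ∀ T : ℝ, 0 < T → ∀ U : ℝ → 𝓗 →L[ℂ] 𝓗, S.IsEvolution ħ T U →
      ∀ s ∈ Set.Icc (0 : ℝ) 1,
        ‖U s ∘L S.diffProjector k δk 0 - S.diffProjector k δk s ∘L U s‖ ≤ C / T ∧
        ∀ ψ : 𝓗, S.diffProjector k δk 0 ψ = ψ →
          ‖U s ψ - S.diffProjector k δk s (U s ψ)‖ ≤ C / T * ‖ψ‖ := by
  have hu : UniqueDiffOn ℝ (Icc (0 : ℝ) 1) := uniqueDiffOn_Icc zero_lt_one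
  have hP1 : ∀ s ∈ Icc (0 : ℝ) 1, HasDerivWithinAt (fun s => S.diffProjector k δk s)
      (derivWithin (fun s => S.diffProjector k δk s) (Icc 0 1) s) (Icc 0 1) s := fun s hs =>
    (hP.differentiableOn two_ne_zero s hs).hasDerivWithinAt
  obtain ⟨X, ⟨K, hK0, hX, hX'⟩, hcX⟩ := ContinuousSpectrum.exists_weak_commutator_eq_deriv hE hφ
    -- The second derivative of the projector is used only here, to make `P'` Lipschitz.
    hwindow hgap (LipFamily.of_contDiffOn (hP.derivWithin hu (m := 1) (by norm_num))) hP1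
  have hcP : ∀ s ∈ Icc (0 : ℝ) 1, ∀ f g : (S.hamiltonian s).domain,
      inner ℂ (S.hamiltonian s f) (S.diffProjector k δk s g) =
        inner ℂ (f : 𝓗) (S.diffProjector k δk s (S.hamiltonian s g)) := fun s _ f g => by
    have hw := isMultiplier_one.indicator (measurableSet_Icc (a := k) (b := k + δk))
    have h1 := ContinuousSpectrum.inner_hamiltonian_fromAmplitude (S := S) (s := s) (B := 0)
      (fun f g => by
        rw [inner_mulOperator_boundedMul hw f g, sub_self, _root_.zero_apply, inner_zero_right])
      f g
    rw [← ContinuousSpectrum.diffProjector_eq, ContinuousSpectrum.fromAmplitude_apply,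
      _root_.zero_apply, map_zero, inner_zero_right] at h1
    exact sub_eq_zero.1 h1
  refine ⟨3 * ħ * K, fun T hT U hU s hs => ?_⟩
  have hnorm : ‖U s ∘L S.diffProjector k δk 0 - S.diffProjector k δk s ∘L U s‖ ≤
      3 * ħ * K / T := by
    refine norm_comp_sub_comp_le (hU.isometry s hs) (hU.surjective s hs)
      (S.dense_hamiltonian_domain (s := 0) (by simp)) (by positivity) fun f hf g hg => ?_
    have h1 := norm_inner_sub_inner_le hP1 hK0 hX hX' hcP hcX hħ hT (u := fun r => U r f)
      (w := fun r => U r g) (fun r hr => hU.schroedinger f hf r hr)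
      (fun r hr => hU.schroedinger g hg r hr) (fun r hr => (hU.isometry r hr f).le)
      (fun r hr => (hU.isometry r hr g).le) s hs
    simpa only [hU.initial, one_apply_eq_self] using h1
  refine ⟨hnorm, fun ψ hψ => ?_⟩
  have h1 := ContinuousLinearMap.le_of_opNorm_le _ hnorm ψ
  rwa [_root_.sub_apply, ContinuousLinearMap.comp_apply, ContinuousLinearMap.comp_apply, hψ] at h1
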